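/- **Conventions.** A signature $\sigma$ is a finite set of relation symbols, each with an arity in $\mathbb N$ (arity $0$ allowed); a $\sigma$-structure $\mathcal A$ has a finite universe $A$ and a relation $R(\mathcal A)\subseteq A^{\mathrm{ar}(R)}$ for each $R\in\sigma$. The Gaifman graph of $\mathcal A$ joins $a\ne b$ if they occur together in a tuple of some relation of $\mathcal A$; the degree of $\mathcal A$ is its maximum degree, and $\mathrm{dist}^{\mathcal A}$ is its graph distance. For tuples $\bar a$ (or several tuples), $N_r^{\mathcal A}(\bar a)$ is the set of elements at distance at most $r$ from some entry of $\bar a$ (empty if $\bar a$ is the empty tuple), and $\mathcal N_r^{\mathcal A}(\bar a)$ is the substructure of $\mathcal A$ induced on it. Fix a collection of numerical predicates (finitely many names $\mathsf P$, each with an arity $\ge1$ and a semantics $[\![\mathsf P]\!]\subseteq\mathbb Z^{\mathrm{ar}(\mathsf P)}$). $\mathrm{FOC}_1[\sigma]$ has formulas $x=y$, $R(\bar x)$, $\neg\phi$, $(\phi\lor\psi)$, $\exists x\,\phi$, and $\mathsf P(t_1,\dots,t_n)$ for terms $t_i$ that together have at most one free variable, and terms $\#\bar z.\phi$ (the number of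 tuples $\bar z$, of pairwise distinct variables, satisfying $\phi$), integers $i\in\mathbb Z$, $(t_1+t_2)$, $(t_1\cdot t_2)$. $\mathrm{FO}[\sigma]$ is the fragment without numerical predicates and terms. The size of an expression is its length as a string, integers and variables having length $1$; $\mathrm{FOC}_1[\sigma,n,q]$ is the set of $\mathrm{FOC}_1[\sigma]$-expressions with at most $n$ free variables and size at most $q$. Writing $\phi(\bar x)$ means that the free variables of $\phi$ are among $\bar x$. A formula $\phi(\bar x)$ is $r$-local (around $\bar x$) if $\mathcal A\models\phi[\bar a]\iff\mathcal N_r^{\mathcal A}(\bar a)\models\phi[\bar a]$ for all $\sigma$-structures $\mathcal A$ and all tuples $\bar a$ in $A$. Graphs are finite, undirected and simple. For a graph $G$ on $[n]=\{1,\dots,n\}$ and a tuple $\bar x=(x_1,\dots,x_n)$ of pairwise distinct variables, $\delta^\sigma_{G,r}(\bar x)$ is the $\mathrm{FO}[\sigma]$-formula $$\bigwedge_{\{i,j\}\in E(G)}\mathrm{dist}^\sigma(x_i,x_j)\le r\ \land\bigwedge_{\{i,j\}\notin E(G),\ i\ne j}\neg\,\mathrm{dist}^\sigma(x_i,x_j)\le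 r ,$$ where $\mathrm{dist}^\sigma(x,y)\le r$ is a fixed $\mathrm{FO}[\sigma]$-formula expressing that the Gaifman distance is at most $r$. Let $\nu_d(r)=1+d\sum_{0\le i<r}(d-1)^i$. For $N\subseteq A$ and $\bar w,\bar w'\in A^\ell$ write $\bar w=_N\bar w'$ if $w_i=w'_i$ for all $i\in[\ell]$ with $w_i\in N$. **Lemma.** Let $\sigma'$ be a signature and $r',k,\ell,m\in\mathbb N$ with $k+\ell+m\ge1$. Let $\phi'(\bar x,\bar y,\bar z)$ be an $r'$-local $\mathrm{FO}[\sigma']$-formula, where $\bar x,\bar y,\bar z$ are tuples of lengths $k,\ell,m$ of variables, all of them pairwise distinct. Let $G$ be a graph with vertex set $[k+\ell+m]$, and let $$u_G(\bar x,\bar y):=\#\bar z.\bigl(\phi'(\bar x,\bar y,\bar z)\land\delta^{\sigma'}_{G,2r'+1}(\bar x,\bar y,\bar z)\bigr).$$ There is a number $q_G\in\mathbb N$ such that for every $\sigma'$-structure $\mathcal A'$ with universe $A$ and degree $d$, all $s\ge1$, all $\bar v_1,\dots,\bar v_s\in A^k$ and all $\bar w\in A^\ell$ there is an $\mathrm{FOC}_1[\sigma',k+\ell,q_G]$-term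 $u'_G(\bar x,\bar y)$ with the following properties, where $N:=N^{\mathcal A'}_{(2r'+1)(\ell+m)}(\bar v_1,\dots,\bar v_s)$. 1. For all $\bar w'\in A^\ell$ with $\bar w=_N\bar w'$ and all $i\in[s]$, $$(u_G)^{\mathcal A'}[\bar v_i,\bar w]=(u'_G)^{\mathcal A'}[\bar v_i,\bar w'].$$ 2. $u'_G$ is a combination, via addition and multiplication, of integers $i$ with $-1\le i\le\bigl(\ell\cdot\nu_d((2r'+1)m)\bigr)^m$ and of counting terms of the form $\#\bar z'.(\psi\land\delta^{\sigma'}_{H,2r'+1})(\bar u,\bar z')$ with $|\bar z'|\le m$, where $\bar u$ is a tuple of variables from $\bar x,\bar y$, the variables of $(\bar u,\bar z')$ are pairwise distinct, $H$ is a connected graph with vertex set $[|\bar u|+|\bar z'|]$, and $\psi(\bar u,\bar z')$ is an $\mathrm{FO}[\sigma']$-formula that is $r'$-local around $(\bar u,\bar z')$. -/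

import Mathlib

namespace FOC1

/-- A numerical predicate collection: finitely many predicate names, each with an arity `≥ 1` and
a semantics `⊆ ℤ ^ arity`. -/
structure NumPredicates where
  Name : Type
  finite_name : Finite Name
  arity : Name → ℕ
  arity_pos : ∀ p, 1 ≤ arity p
  sem : ∀ p, Set (Fin (arity p) → ℤ)

/-! ### Syntax. The set of variables is `ℕ`. A signature is a relational `FirstOrder.Language`
with finitely many relation symbols. -/

mutual
/-- Formulas. The restriction of rule `pred` that is specific to `FOC₁` is `Formula.IsFOC1`. -/
inductive Formula (L : FirstOrder.Language.{0, 0}) (P : NumPredicates) : Type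
  | eq (x y : ℕ) : Formula L P
  | rel {n : ℕ} (R : L.Relations n) (x : Fin n → ℕ) : Formula L P
  | neg (φ : Formula L P) : Formula L P
  | or (φ ψ : Formula L P) : Formula L P
  | ex (x : ℕ) (φ : Formula L P) : Formula L P
  | pred (p : P.Name) (t : Fin (P.arity p) → Term L P) : Formula L P
/-- Counting terms; `count x φ` is `#(x₁, …, xₙ).φ` for pairwise distinct variables `xᵢ`. -/
inductive Term (L : FirstOrder.Language.{0, 0}) (P : NumPredicates) : Type
  | count {n : ℕ} (x : Fin n ↪ ℕ) (φ : Formula L P) : Term L P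
  | int (i : ℤ) : Term L P
  | add (t₁ t₂ : Term L P) : Term L P
  | mul (t₁ t₂ : Term L P) : Term L P
end

variable {L : FirstOrder.Language.{0, 0}} {P : NumPredicates}

mutual
/-- Free variables of a formula. -/
def Formula.free : Formula L P → Finset ℕ
  | .eq x y => {x, y}
  | .rel _ x => Finset.univ.image x
  | .neg φ => φ.free
  | .or φ ψ => φ.free ∪ ψ.free
  | .ex x φ => φ.free \ {x}
  | .pred _ t => Finset.univ.biUnion fun i => (t i).free
/-- Free variables of a counting term. -/
def Term.free : Term L P → Finset ℕ
  | .count x φ => φ.free \ Finset.univ.image x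
  | .int _ => ∅
  | .add t₁ t₂ => t₁.free ∪ t₂.free
  | .mul t₁ t₂ => t₁.free ∪ t₂.free
end

mutual
/-- `φ` is an `FOC₁` formula: the arguments of each numerical predicate have together at most
one free variable. -/
def Formula.IsFOC1 : Formula L P → Prop
  | .eq _ _ => True
  | .rel _ _ => True
  | .neg φ => φ.IsFOC1
  | .or φ ψ => φ.IsFOC1 ∧ ψ.IsFOC1
  | .ex _ φ => φ.IsFOC1
  | .pred _ t => (∀ i, (t i).IsFOC1) ∧ (Finset.univ.biUnion fun i => (t i).free).card ≤ 1
/-- `t` is an `FOC₁` counting term. -/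
def Term.IsFOC1 : Term L P → Prop
  | .count _ φ => φ.IsFOC1
  | .int _ => True
  | .add t₁ t₂ => t₁.IsFOC1 ∧ t₂.IsFOC1
  | .mul t₁ t₂ => t₁.IsFOC1 ∧ t₂.IsFOC1
end

mutual
/-- Length of the formula as a string, integers and variables having length one:
`x=y`, `R(x,…,x)`, `¬φ`, `(φ∨ψ)`, `∃xφ`, `P(t,…,t)`. -/
def Formula.size : Formula L P → ℕ
  | .eq _ _ => 3
  | .rel (n := n) _ _ => 3 + n + (n - 1)
  | .neg φ => 1 + φ.size
  | .or φ ψ => 3 + φ.size + ψ.size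
  | .ex _ φ => 2 + φ.size
  | .pred p t => 3 + (∑ i, (t i).size) + (P.arity p - 1)
/-- Length of the term as a string: `#(x,…,x).φ`, `i`, `(t+t)`, `(t·t)`. -/
def Term.size : Term L P → ℕ
  | .count (n := n) _ φ => 4 + n + (n - 1) + φ.size
  | .int _ => 1
  | .add t₁ t₂ => 3 + t₁.size + t₂.size
  | .mul t₁ t₂ => 3 + t₁.size + t₂.size
end

/-- First-order formulas: those built without numerical predicates and counting terms. -/
inductive Formula.IsFO : Formula L P → Prop
  | eq (x y : ℕ) : IsFO (.eq x y)
  | rel {n : ℕ} (R : L.Relations n) (x : Fin n → ℕ) : IsFO (.rel R x)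
  | neg {φ : Formula L P} : IsFO φ → IsFO (.neg φ)
  | or {φ ψ : Formula L P} : IsFO φ → IsFO ψ → IsFO (.or φ ψ)
  | ex (x : ℕ) {φ : Formula L P} : IsFO φ → IsFO (.ex x φ)

/-- The set `FOC₁[σ, m, q]` of terms of size at most `q` with at most `m` free variables. -/
def Term.InFOC1 (m q : ℕ) (t : Term L P) : Prop :=
  t.IsFOC1 ∧ t.free.card ≤ m ∧ t.size ≤ q

/-! ### Semantics -/

mutual
/-- `(A, β) ⊨ φ`. -/
noncomputable def Formula.Realize {A : Type} [L.Structure A] : Formula L P → (ℕ → A) → Prop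
  | .eq x y, β => β x = β y
  | .rel R x, β => FirstOrder.Language.Structure.RelMap R (fun i => β (x i))
  | .neg φ, β => ¬ φ.Realize β
  | .or φ ψ, β => φ.Realize β ∨ ψ.Realize β
  | .ex x φ, β => ∃ a : A, φ.Realize (Function.update β x a)
  | .pred p t, β => (fun i => (t i).eval β) ∈ P.sem p
/-- The value of a term in `(A, β)`; `Function.extend x a β` is `β` with `xᵢ` reset to `aᵢ`. -/
noncomputable def Term.eval {A : Type} [L.Structure A] : Term L P → (ℕ → A) → ℤ
  | .count (n := n) x φ, β => (Nat.card {a : Fin n → A // φ.Realize (Function.extend x a β)} : ℤ)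
  | .int i, _ => i
  | .add t₁ t₂, β => t₁.eval β + t₂.eval β
  | .mul t₁ t₂, β => t₁.eval β * t₂.eval β
end

/-- `A ⊨ φ[a]` for a formula `φ(x)`: `(A, β) ⊨ φ` for all `β` with `β(xᵢ) = aᵢ`. -/
def Models (A : Type) [L.Structure A] {n : ℕ} (φ : Formula L P) (x : Fin n → ℕ) (a : Fin n → A) :
    Prop :=
  ∀ β : ℕ → A, (∀ i, β (x i) = a i) → φ.Realize β

/-! ### Gaifman graph, balls, locality -/

/-- The Gaifman graph of a structure. -/
def gaifman (L : FirstOrder.Language.{0, 0}) (A : Type) [L.Structure A] : SimpleGraph A where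
  Adj v w := v ≠ w ∧ ∃ (n : ℕ) (R : L.Relations n) (a : Fin n → A),
    FirstOrder.Language.Structure.RelMap R a ∧ v ∈ Set.range a ∧ w ∈ Set.range a
  symm := ⟨fun _ _ ⟨h, n, R, a, hR, hv, hw⟩ => ⟨h.symm, n, R, a, hR, hw, hv⟩⟩
  loopless := ⟨fun _ h => h.1 rfl⟩

/-- The degree of a (finite) structure: the maximum degree of its Gaifman graph. -/
noncomputable def degree (L : FirstOrder.Language.{0, 0}) (A : Type) [L.Structure A] : ℕ :=
  ⨆ v : A, ((gaifman L A).neighborSet v).ncard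

/-- The ball of radius `r` around the family `a`: the elements at distance `≤ r` from some `aᵢ`. -/
def ball (L : FirstOrder.Language.{0, 0}) {A : Type} [L.Structure A] {ι : Type} (r : ℕ) (a : ι → A) : Set A :=
  {b | ∃ i, (gaifman L A).edist (a i) b ≤ r}

theorem mem_ball (L : FirstOrder.Language.{0, 0}) {A : Type} [L.Structure A] {ι : Type} (r : ℕ)
    (a : ι → A)
    (i : ι) : a i ∈ ball L r a :=
  ⟨i, by simp⟩

/-- The induced substructure on a set of elements (for a relational language). -/
@[reducible] def induced (L : FirstOrder.Language.{0, 0}) [L.IsRelational] {A : Type} [L.Structure A]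
    (X : Set A) : L.Structure X where
  funMap f := isEmptyElim f
  RelMap R a := FirstOrder.Language.Structure.RelMap R (fun i => (a i : A))

/-- `φ(x)` is `r`-local around `x`: for every finite structure `A` and every tuple `a`,
`A ⊨ φ[a]` iff `φ[a]` holds in the `r`-neighbourhood of `a`, the induced substructure on the
`r`-ball around `a`. -/
def IsLocal [L.IsRelational] {n : ℕ} (r : ℕ) (φ : Formula L P) (x : Fin n → ℕ) : Prop :=
  (φ.free : Set ℕ) ⊆ Set.range x ∧
  ∀ (A : Type) [Finite A] [L.Structure A] (a : Fin n → A),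
    Models A φ x a ↔
      letI := induced L (ball L r a)
      Models (ball L r a) φ x (fun i => ⟨a i, mem_ball L r a i⟩)

/-! ### Distance formulas -/

/-- `(φ ∧ ψ)` abbreviates `¬(¬φ ∨ ¬ψ)`. -/
def Formula.and (φ ψ : Formula L P) : Formula L P := .neg (.or (.neg φ) (.neg ψ))

/-- A valid sentence, the empty conjunction. -/
def Formula.verum : Formula L P := .ex 0 (.eq 0 0)

def Formula.bigAnd (l : List (Formula L P)) : Formula L P := l.foldr Formula.and .verum

def Formula.bigOr (l : List (Formula L P)) : Formula L P := l.foldr Formula.or (.neg .verum)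

def Formula.exMany (l : List ℕ) (φ : Formula L P) : Formula L P := l.foldr Formula.ex φ

/-- `x` and `y` are adjacent in the Gaifman graph; the variables `x + y + 1 + i` are fresh. -/
noncomputable def Formula.adj [Finite (Σ n, L.Relations n)] (x y : ℕ) : Formula L P :=
  letI : Fintype (Σ n, L.Relations n) := Fintype.ofFinite _
  .and (.neg (.eq x y)) <| .bigOr <|
    (Finset.univ : Finset (Σ n, L.Relations n)).toList.flatMap fun R =>
      (List.finRange R.1 ×ˢ List.finRange R.1).map fun ij =>
        .exMany ((List.range R.1).map fun i => x + y + 1 + i) <|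
          .and (.rel R.2 fun i => x + y + 1 + (i : ℕ))
            (.and (.eq (x + y + 1 + (ij.1 : ℕ)) x) (.eq (x + y + 1 + (ij.2 : ℕ)) y))

/-- The first-order formula `dist(x, y) ≤ r`. -/
noncomputable def Formula.distLE [Finite (Σ n, L.Relations n)] : ℕ → ℕ → ℕ → Formula L P
  | 0, x, y => .eq x y
  | r + 1, x, y => .or (Formula.distLE r x y)
      (.ex (x + y + 1) (.and (Formula.distLE r x (x + y + 1)) (.adj (x + y + 1) y)))

open Classical in
/-- The formula `δ_{G,r}(x)`: for `i ≠ j`, `dist(xᵢ, xⱼ) ≤ r` if `{i,j}` is an edge of `G`, and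
`dist(xᵢ, xⱼ) > r` otherwise. -/
noncomputable def Formula.delta [Finite (Σ n, L.Relations n)] {n : ℕ} (G : SimpleGraph (Fin n))
    (r : ℕ) (x : Fin n → ℕ) : Formula L P :=
  let pairs := (List.finRange n ×ˢ List.finRange n).filter fun ij => ij.1 < ij.2
  .and
    (.bigAnd ((pairs.filter fun ij => G.Adj ij.1 ij.2).map fun ij => .distLE r (x ij.1) (x ij.2)))
    (.bigAnd ((pairs.filter fun ij => ¬ G.Adj ij.1 ij.2).map fun ij =>
      .neg (.distLE r (x ij.1) (x ij.2))))

/-! ### The distance formulas define what they should -/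

section

variable {A : Type} [L.Structure A]

theorem realize_and (φ ψ : Formula L P) (β : ℕ → A) :
    (φ.and ψ).Realize β ↔ φ.Realize β ∧ ψ.Realize β := by
  simp only [Formula.and, Formula.Realize]; tauto

theorem realize_verum (β : ℕ → A) : (Formula.verum : Formula L P).Realize β := by
  simp only [Formula.verum, Formula.Realize]; exact ⟨β 0, trivial⟩

theorem realize_bigAnd (l : List (Formula L P)) (β : ℕ → A) :
    (Formula.bigAnd l).Realize β ↔ ∀ φ ∈ l, φ.Realize β := by
  induction l with
  | nil => simpa [Formula.bigAnd] using realize_verum β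
  | cons a l ih => simp_all [Formula.bigAnd, realize_and]

theorem realize_bigOr (l : List (Formula L P)) (β : ℕ → A) :
    (Formula.bigOr l).Realize β ↔ ∃ φ ∈ l, φ.Realize β := by
  induction l with
  | nil => simpa [Formula.bigOr, Formula.Realize] using realize_verum β
  | cons a l ih => simp_all [Formula.bigOr, Formula.Realize]

theorem realize_exMany (l : List ℕ) (φ : Formula L P) (β : ℕ → A) :
    (Formula.exMany l φ).Realize β ↔ ∃ γ : ℕ → A, (∀ i ∉ l, γ i = β i) ∧ φ.Realize γ := by
  induction l generalizing β with
  | nil =>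
    simp only [Formula.exMany, List.foldr_nil]
    constructor
    · exact fun h => ⟨β, by simp, h⟩
    · rintro ⟨γ, h, h'⟩
      have : γ = β := by funext i; exact h i (by simp)
      exact this ▸ h'
  | cons a l ih =>
    simp only [Formula.exMany, List.foldr_cons, Formula.Realize] at ih ⊢
    simp only [ih]
    constructor
    · rintro ⟨b, γ, h, h'⟩
      refine ⟨γ, fun i hi => ?_, h'⟩
      simp only [List.mem_cons, not_or] at hi
      rw [h i hi.2, Function.update_of_ne hi.1]
    · rintro ⟨γ, h, h'⟩
      refine ⟨γ a, γ, fun i hi => ?_, h'⟩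
      by_cases hia : i = a
      · subst hia; simp
      · rw [Function.update_of_ne hia]; exact h i (by simp [hia, hi])

theorem realize_adj [Finite (Σ n, L.Relations n)] (x y : ℕ) (β : ℕ → A) :
    (Formula.adj x y : Formula L P).Realize β ↔ (gaifman L A).Adj (β x) (β y) := by
  simp only [Formula.adj, realize_and, realize_bigOr, Formula.Realize, gaifman]
  refine and_congr_right fun _ => ?_
  constructor
  · rintro ⟨φ, hφ, h⟩
    simp only [List.mem_flatMap, List.mem_map] at hφ
    obtain ⟨⟨n, R⟩, -, ij, -, rfl⟩ := hφ
    rw [realize_exMany] at h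
    obtain ⟨γ, hγ, h⟩ := h
    simp only [realize_and, Formula.Realize] at h
    have e : ∀ t, t ≤ x + y → γ t = β t := fun t ht => hγ t (by
      simp only [List.mem_map, not_exists, not_and]; intros; omega)
    refine ⟨n, R, _, h.1, ⟨ij.1, ?_⟩, ⟨ij.2, ?_⟩⟩
    · simpa [e x (by omega)] using h.2.1
    · simpa [e y (by omega)] using h.2.2
  · rintro ⟨n, R, a, hR, ⟨i, hi⟩, ⟨j, hj⟩⟩
    refine ⟨_, List.mem_flatMap.2 ⟨⟨n, R⟩, by simp, List.mem_map.2 ⟨(i, j), by simp, rfl⟩⟩, ?_⟩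
    rw [realize_exMany]
    let γ : ℕ → A := fun t => if h : x + y + 1 ≤ t ∧ t - (x + y + 1) < n then
      a ⟨t - (x + y + 1), h.2⟩ else β t
    have g : ∀ i : Fin n, γ (x + y + 1 + i) = a i := fun i => by
      simp only [γ]
      rw [dif_pos ⟨by omega, by omega⟩]
      congr 1; ext; simp
    have e : ∀ t, t ≤ x + y → γ t = β t := fun t ht => by
      simp only [γ]; rw [dif_neg (by omega)]
    refine ⟨γ, fun t ht => ?_, ?_⟩
    · simp only [γ]
      rw [dif_neg]
      rintro ⟨h1, h2⟩
      exact ht (List.mem_map.2 ⟨t - (x+y+1), by simpa using h2, by omega⟩)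
    · simp only [realize_and, Formula.Realize, g, e x (by omega), e y (by omega)]
      exact ⟨hR, hi, hj⟩

theorem edist_succ {V : Type} (G : SimpleGraph V) (r : ℕ) (a b : V) :
    G.edist a b ≤ (r + 1 : ℕ) ↔ G.edist a b ≤ r ∨ ∃ c, G.edist a c ≤ r ∧ G.Adj c b := by
  constructor
  · intro h
    by_cases h' : G.edist a b ≤ r
    · exact .inl h'
    right
    obtain ⟨p, hp⟩ := SimpleGraph.exists_walk_of_edist_ne_top (G := G) (u := a) (v := b)
      (ne_top_of_le_ne_top (by simp) h)
    have hl : p.length = r + 1 := by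
      rw [← hp] at h h'; simp only [Nat.cast_le] at h h'; omega
    have hn : ¬ p.Nil := by rw [← SimpleGraph.Walk.length_eq_zero_iff]; omega
    refine ⟨p.penultimate, ?_, p.adj_penultimate hn⟩
    refine (SimpleGraph.Walk.edist_le p.dropLast).trans ?_
    simp [hl]
  · rintro (h | ⟨c, h, h'⟩)
    · exact h.trans (by simp)
    · refine (SimpleGraph.edist_triangle (v := c)).trans ?_
      push_cast
      exact add_le_add h (SimpleGraph.edist_eq_one_iff_adj.2 h').le

theorem realize_distLE [Finite (Σ n, L.Relations n)] (r x y : ℕ) (β : ℕ → A) :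
    (Formula.distLE r x y : Formula L P).Realize β ↔ (gaifman L A).edist (β x) (β y) ≤ r := by
  induction r generalizing x y β with
  | zero => simp [Formula.distLE, Formula.Realize]
  | succ r ih =>
    have e1 : x ≠ x + y + 1 := by omega
    have e2 : y ≠ x + y + 1 := by omega
    simp only [Formula.distLE, Formula.Realize, realize_and, ih, realize_adj, edist_succ,
      Function.update_self, Function.update_of_ne e1, Function.update_of_ne e2]

theorem realize_delta [Finite (Σ n, L.Relations n)] {n : ℕ} (G : SimpleGraph (Fin n)) (r : ℕ)
    (x : Fin n → ℕ) (β : ℕ → A) :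
    (Formula.delta G r x : Formula L P).Realize β ↔
      ∀ i j, i ≠ j → (G.Adj i j ↔ (gaifman L A).edist (β (x i)) (β (x j)) ≤ r) := by
  simp only [Formula.delta, realize_and, realize_bigAnd, List.forall_mem_map, List.mem_filter,
    Formula.Realize, realize_distLE, decide_eq_true_eq]
  constructor
  · rintro ⟨h1, h2⟩ i j hij
    rcases lt_or_gt_of_ne hij with h | h
    · refine ⟨fun hG => h1 (i, j) ⟨⟨by simp, h⟩, hG⟩, fun hd => ?_⟩
      by_contra hG
      exact h2 (i, j) ⟨⟨by simp, h⟩, hG⟩ hd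
    · rw [G.adj_comm, SimpleGraph.edist_comm]
      refine ⟨fun hG => h1 (j, i) ⟨⟨by simp, h⟩, hG⟩, fun hd => ?_⟩
      by_contra hG
      exact h2 (j, i) ⟨⟨by simp, h⟩, hG⟩ hd
  · intro h
    exact ⟨fun p hp => (h _ _ hp.1.2.ne).1 hp.2, fun p hp hd => hp.2 ((h _ _ hp.1.2.ne).2 hd)⟩

end

/-! ### Notions used in the statement -/

/-- `ν_d(r) = 1 + d · ∑_{i < r} (d - 1)^i`. (For `d = 0` the factor `d` makes the truncated
subtraction irrelevant.) -/
def nu (d r : ℕ) : ℕ := 1 + d * ∑ i ∈ Finset.range r, (d - 1) ^ i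

/-- `w` and `w'` agree at all positions where the entry of `w` lies in `N` (not symmetric). -/
def AgreeOn {A : Type} {n : ℕ} (N : Set A) (w w' : Fin n → A) : Prop :=
  ∀ i, w i ∈ N → w i = w' i

/-- Combinations, via addition and multiplication, of terms from a set `B`. -/
inductive IsCombination (B : Term L P → Prop) : Term L P → Prop
  | base {t : Term L P} : B t → IsCombination B t
  | add {t₁ t₂ : Term L P} : IsCombination B t₁ → IsCombination B t₂ → IsCombination B (.add t₁ t₂)
  | mul {t₁ t₂ : Term L P} : IsCombination B t₁ → IsCombination B t₂ → IsCombination B (.mul t₁ t₂)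

/-- `t` is a counting term `#z'.(ψ ∧ δ_{H,2r+1})` with `|z'| ≤ m`, for a connected graph `H` and a
first-order formula `ψ`. Here the vertices of `H` correspond to the tuple `(u, z')` of pairwise
distinct variables, where the entries of `u` are among the variables `V`, and `ψ(u, z')` is
`r`-local around this tuple. -/
def IsConnectedCount [L.IsRelational] [Finite (Σ n, L.Relations n)] (r m : ℕ) (V : Set ℕ)
    (t : Term L P) : Prop :=
  ∃ (n p : ℕ) (u : Fin n → ℕ) (z' : Fin p ↪ ℕ) (H : SimpleGraph (Fin (n + p)))
    (ψ : Formula L P),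
    p ≤ m ∧ Set.range u ⊆ V ∧ Function.Injective (Fin.append u z') ∧ H.Connected ∧
    ψ.IsFO ∧ IsLocal r ψ (Fin.append u z') ∧
    t = .count z' (.and ψ (.delta H (2 * r + 1) (Fin.append u z')))

end FOC1

namespace FOC1

variable {L : FirstOrder.Language.{0, 0}} {P : NumPredicates}

-- The proof separates a syntactic step, uniform in the structure, from a substitution that depends
-- on it.
--
-- Syntactic step (`isPoly_cnt`). If the configuration graph `G` is connected, the count is itself
-- an admissible term. Otherwise the variables split into nonempty parts `S₁`, `S₂` without
-- `G`-edges between them. The distance formula then puts the two parts more than `2r + 1` apart, so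
-- their `r`-neighbourhoods are disjoint and no relation tuple meets both. A Feferman–Vaught
-- argument (`exists_split_pairs`, `LocalOn.exists_split`) rewrites the local formula as a finite
-- disjunction of conjunctions `α ∧ χ`, with `α` local around `S₁` and `χ` local around `S₂`;
-- inclusion–exclusion reduces the count to single conjunctions. For one of these, the product of
-- the counts on `S₁` and `S₂` also includes the assignments in which some cross pair is close.
-- Those are sorted by the nonempty set `E` of close cross pairs, have configuration `G + E`, and
-- are subtracted. The factors have fewer variables and the corrections more edges, so induction on
-- the number of non-edges applies. The result is a polynomial in connected counting terms with
-- constants `0` and `-1`; it does not depend on the structure, and its size serves as the bound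
-- `q`.
--
-- Substitution (`IsConnectedCount.exists_sameValues`). Given the structure, the `vᵢ` and `w`,
-- consider one connected counting term. If all `w`-entries it uses lie in `N`, the term is kept,
-- since `w'` agrees with `w` there. If it uses an entry outside `N` together with some
-- `x`-variable, its value is `0`: a connected configuration would link that entry to an entry of
-- `vᵢ` by at most `l + m` steps of length `2r + 1`. If it uses an entry outside `N` and no
-- `x`-variable, its value depends on `w` alone and becomes an integer constant, bounded through the
-- size of a ball around `w`. Constants have size one, so the term does not grow.
--
-- Locality is handled throughout by relativized quantifiers inside one structure (`LocalOn`), which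
-- avoids carrying valuations back and forth between substructures.

/-! ### Relativized semantics -/

/-- First-order semantics with all quantifiers restricted to the set `X`. -/
def Formula.RealizeOn {A : Type} [L.Structure A] (X : Set A) : Formula L P → (ℕ → A) → Prop
  | .eq x y, β => β x = β y
  | .rel R x, β => FirstOrder.Language.Structure.RelMap R (fun i => β (x i))
  | .neg φ, β => ¬ φ.RealizeOn X β
  | .or φ ψ, β => φ.RealizeOn X β ∨ ψ.RealizeOn X β
  | .ex x φ, β => ∃ a ∈ X, φ.RealizeOn X (Function.update β x a)
  -- A junk value: relativization is applied only to first-order formulas.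
  | .pred _ _, _ => False

theorem realizeOn_congr {A : Type} [L.Structure A] (X : Set A) {φ : Formula L P} (h : φ.IsFO)
    {β β' : ℕ → A} (hβ : ∀ v ∈ φ.free, β v = β' v) :
    φ.RealizeOn X β ↔ φ.RealizeOn X β' := by
  induction h generalizing β β' with
  | eq x y => simp_all [Formula.RealizeOn, Formula.free]
  | rel R x =>
    have : (fun i => β (x i)) = fun i => β' (x i) :=
      funext fun i => hβ _ (by simp [Formula.free])
    simp only [Formula.RealizeOn, this]
  | neg _ ih => simp only [Formula.RealizeOn]; exact not_congr (ih hβ)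
  | or _ _ ih₁ ih₂ =>
    simp only [Formula.free, Finset.mem_union] at hβ
    simp only [Formula.RealizeOn]
    exact or_congr (ih₁ fun v hv => hβ v (.inl hv)) (ih₂ fun v hv => hβ v (.inr hv))
  | ex x _ ih =>
    simp only [Formula.RealizeOn]
    refine exists_congr fun a => and_congr_right fun _ => ih fun v hv => ?_
    by_cases hvx : v = x
    · subst hvx; simp
    · rw [Function.update_of_ne hvx, Function.update_of_ne hvx]
      exact hβ v (by simp [Formula.free, hv, hvx])

theorem realizeOn_univ {A : Type} [L.Structure A] {φ : Formula L P} (h : φ.IsFO) (β : ℕ → A) :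
    φ.RealizeOn Set.univ β ↔ φ.Realize β := by
  induction h generalizing β <;> simp_all [Formula.RealizeOn, Formula.Realize]

theorem realize_congr {A : Type} [L.Structure A] {φ : Formula L P} (h : φ.IsFO)
    {β β' : ℕ → A} (hβ : ∀ v ∈ φ.free, β v = β' v) : φ.Realize β ↔ φ.Realize β' := by
  rw [← realizeOn_univ h, ← realizeOn_univ h, realizeOn_congr _ h hβ]

/-- Relativizing inside a substructure is relativizing in the ambient structure to the image set.
This is the only bridge between the semantics of `X` and that of `A`. -/
theorem realizeOn_induced [L.IsRelational] {A : Type} [L.Structure A] (X : Set A) (Y : Set X)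
    {φ : Formula L P} (h : φ.IsFO) (β : ℕ → X) :
    (letI := induced L X; φ.RealizeOn Y β) ↔
      φ.RealizeOn (Subtype.val '' Y) (fun v => (β v : A)) := by
  let := induced L X
  induction h generalizing β with
  | eq x y => simp [Formula.RealizeOn, Subtype.ext_iff]
  | rel R x => rfl
  | neg _ ih => simp only [Formula.RealizeOn]; exact not_congr (ih β)
  | or _ _ ih₁ ih₂ => simp only [Formula.RealizeOn]; exact or_congr (ih₁ β) (ih₂ β)
  | ex x _ ih =>
    simp only [Formula.RealizeOn, Set.exists_mem_image]
    refine exists_congr fun a => and_congr_right fun _ => (ih _).trans (iff_of_eq ?_)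
    congr 1
    funext v
    by_cases hv : v = x
    · subst hv; simp
    · simp [Function.update_of_ne hv]

theorem realize_induced [L.IsRelational] {A : Type} [L.Structure A] (X : Set A)
    {φ : Formula L P} (h : φ.IsFO) (β : ℕ → X) :
    (letI := induced L X; φ.Realize β) ↔ φ.RealizeOn X (fun v => (β v : A)) := by
  let := induced L X
  rw [← realizeOn_univ h β, realizeOn_induced X _ h]
  simp

/-! ### Neighbourhoods of sets of variables and locality -/

/-- The elements at distance at most `r` from the value of some variable in `S`. -/
def nbhd (L : FirstOrder.Language.{0, 0}) {A : Type} [L.Structure A] (r : ℕ) (S : Finset ℕ)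
    (β : ℕ → A) : Set A :=
  {b | ∃ i ∈ S, (gaifman L A).edist (β i) b ≤ r}

theorem mem_nbhd_self {A : Type} [L.Structure A] (r : ℕ) {S : Finset ℕ} (β : ℕ → A) {i : ℕ}
    (hi : i ∈ S) : β i ∈ nbhd L r S β :=
  ⟨i, hi, by simp⟩

theorem nbhd_mono {A : Type} [L.Structure A] (r : ℕ) {S T : Finset ℕ} (h : S ⊆ T) (β : ℕ → A) :
    nbhd L r S β ⊆ nbhd L r T β :=
  fun _ ⟨i, hi, hb⟩ => ⟨i, h hi, hb⟩

theorem nbhd_union {A : Type} [L.Structure A] (r : ℕ) (S T : Finset ℕ) (β : ℕ → A) :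
    nbhd L r (S ∪ T) β = nbhd L r S β ∪ nbhd L r T β := by
  ext b; simp [nbhd, or_and_right, exists_or]

theorem nbhd_congr {A : Type} [L.Structure A] (r : ℕ) {S : Finset ℕ} {β β' : ℕ → A}
    (h : ∀ v ∈ S, β v = β' v) : nbhd L r S β = nbhd L r S β' := by
  ext b
  exact exists_congr fun i => and_congr_right fun hi => by rw [h i hi]

theorem ball_eq_nbhd {A : Type} [L.Structure A] (r : ℕ) {n : ℕ} (x : Fin n → ℕ) (β : ℕ → A) :
    ball L r (fun i => β (x i)) = nbhd L r (Finset.univ.image x) β := by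
  ext b; simp [ball, nbhd]

theorem edist_le_of_edist_induced_le [L.IsRelational] {A : Type} [L.Structure A] (X : Set A)
    (a b : X) (r : ℕ) (h : (letI := induced L X; (gaifman L X).edist a b) ≤ r) :
    (gaifman L A).edist (a : A) b ≤ r := by
  let := induced L X
  induction r generalizing b with
  | zero => simpa [Subtype.ext_iff] using h
  | succ r ih =>
    rw [edist_succ] at h ⊢
    rcases h with h | ⟨c, hc, hne, n, R, t, hR, ⟨i, hi⟩, ⟨j, hj⟩⟩
    · exact .inl (ih _ h)
    · exact .inr ⟨c, ih _ hc, fun e => hne (Subtype.ext e), n, R, fun i => t i, hR,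
        ⟨i, by simp [hi]⟩, ⟨j, by simp [hj]⟩⟩

theorem edist_induced_le_of_edist_le [L.IsRelational] {A : Type} [L.Structure A] (X : Set A)
    (a : X) (r : ℕ) (hX : ∀ b, (gaifman L A).edist (a : A) b ≤ r → b ∈ X) (b : A)
    (h : (gaifman L A).edist (a : A) b ≤ r) :
    (letI := induced L X; (gaifman L X).edist a ⟨b, hX b h⟩) ≤ r := by
  let := induced L X
  suffices H : ∀ i : ℕ, i ≤ r → ∀ b : X, (gaifman L A).edist (a : A) b ≤ i →
      (gaifman L X).edist a b ≤ i from H r le_rfl ⟨b, hX b h⟩ h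
  intro i
  induction i with
  | zero => intro _ b hb; simpa [Subtype.ext_iff] using hb
  | succ i ih =>
    intro hi b hb
    rw [edist_succ] at hb ⊢
    rcases hb with hb | ⟨c, hc, hadj⟩
    · exact .inl (ih (by omega) b hb)
    right
    have hcX : c ∈ X := hX c (hc.trans (by exact_mod_cast (by omega : i ≤ r)))
    refine ⟨⟨c, hcX⟩, ih (by omega) ⟨c, hcX⟩ hc, fun e => hadj.1 (congrArg Subtype.val e), ?_⟩
    obtain ⟨-, n, R, t, hR, ⟨j, hj⟩, ⟨j', hj'⟩⟩ := hadj
    -- A Gaifman edge survives in `X` only if the whole tuple witnessing it lies in `X`. Every entry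
    -- equals `c` or is adjacent to it, hence is within `i + 1 ≤ r` of `a`.
    have ht : ∀ e, t e ∈ X := fun e => by
      refine hX _ (le_trans ?_ (by exact_mod_cast hi : ((i + 1 : ℕ) : ℕ∞) ≤ r))
      rw [edist_succ]
      by_cases hce : c = t e
      · left; rw [← hce]; exact hc
      · exact .inr ⟨c, hc, hce, n, R, t, hR, ⟨j, hj⟩, ⟨e, rfl⟩⟩
    exact ⟨n, R, fun e => ⟨t e, ht e⟩, hR, ⟨j, Subtype.ext hj⟩, ⟨j', Subtype.ext hj'⟩⟩

theorem image_nbhd_induced [L.IsRelational] {A : Type} [L.Structure A] (X : Set A) (r : ℕ)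
    (S : Finset ℕ) (β : ℕ → X) (hX : nbhd L r S (fun v => (β v : A)) ⊆ X) :
    Subtype.val '' (letI := induced L X; nbhd L r S β) = nbhd L r S (fun v => (β v : A)) := by
  let := induced L X
  ext b
  constructor
  · rintro ⟨b, ⟨i, hi, hb⟩, rfl⟩
    exact ⟨i, hi, edist_le_of_edist_induced_le X _ _ _ hb⟩
  · rintro ⟨i, hi, hb⟩
    have h : ∀ b, (gaifman L A).edist (β i : A) b ≤ r → b ∈ X := fun b hb => hX ⟨i, hi, hb⟩
    exact ⟨⟨b, h b hb⟩, ⟨i, hi, edist_induced_le_of_edist_le X (β i) r h b hb⟩, rfl⟩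

/-- `φ` is `r`-local around the variables in `S`, in terms of the relativized semantics. -/
def LocalOn (r : ℕ) (S : Finset ℕ) (φ : Formula L P) : Prop :=
  φ.IsFO ∧ φ.free ⊆ S ∧ ∀ (A : Type) [Finite A] [L.Structure A] (β : ℕ → A),
    φ.Realize β ↔ φ.RealizeOn (nbhd L r S β) β

/-- Every valuation whose values on `S` lie in the nonempty set `X` can be replaced by a valuation
into `X`. -/
theorem exists_valuation_subtype {A : Type} {X : Set A} {S : Finset ℕ} (hS : S.Nonempty)
    {β : ℕ → A} (h : ∀ v ∈ S, β v ∈ X) : ∃ γ : ℕ → X, ∀ v ∈ S, (γ v : A) = β v := by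
  classical
  obtain ⟨i, hi⟩ := hS
  exact ⟨fun v => if hv : v ∈ S then ⟨β v, h v hv⟩ else ⟨β i, h i hi⟩, fun v hv => by simp [hv]⟩

theorem models_iff {A : Type} [L.Structure A] {n : ℕ} {φ : Formula L P} (hφ : φ.IsFO)
    {x : Fin n → ℕ} (hfree : (φ.free : Set ℕ) ⊆ Set.range x) {a : Fin n → A} {β : ℕ → A}
    (hβ : ∀ i, β (x i) = a i) : Models A φ x a ↔ φ.Realize β := by
  refine ⟨fun h => h β hβ, fun h γ hγ => (realize_congr hφ fun v hv => ?_).1 h⟩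
  obtain ⟨i, rfl⟩ := hfree hv
  rw [hβ, hγ]

/-- Positivity of `n` is essential here: around the empty tuple the neighbourhood is empty and
carries no valuation, so `Models` would hold there vacuously. -/
theorem isLocal_iff_localOn [L.IsRelational] {n : ℕ} (hn : 0 < n) {r : ℕ} {φ : Formula L P}
    (hφ : φ.IsFO) {x : Fin n → ℕ} (hx : Function.Injective x) :
    IsLocal r φ x ↔ LocalOn r (Finset.univ.image x) φ := by
  have hfr : (φ.free : Set ℕ) ⊆ Set.range x ↔ φ.free ⊆ Finset.univ.image x := by
    rw [← Finset.coe_subset]; simp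
  have key : (φ.free : Set ℕ) ⊆ Set.range x → ∀ (A : Type) [L.Structure A] (β : ℕ → A),
      (letI := induced L (ball L r fun i => β (x i));
        Models (ball L r fun i => β (x i)) φ x
          (fun i => ⟨β (x i), mem_ball L r (fun i => β (x i)) i⟩)) ↔
        φ.RealizeOn (nbhd L r (Finset.univ.image x) β) β := by
    intro hf A _ β
    have hne : (Finset.univ.image x).Nonempty := ⟨x ⟨0, hn⟩, by simp⟩
    obtain ⟨γ, hγ⟩ := exists_valuation_subtype (X := ball L r fun i => β (x i)) (β := β) hne
      (by rw [ball_eq_nbhd]; exact fun v hv => mem_nbhd_self r β hv)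
    let := induced L (ball L r fun i => β (x i))
    rw [models_iff hφ hf (β := γ) (fun i => Subtype.ext (hγ _ (by simp))),
      realize_induced _ hφ, ← ball_eq_nbhd]
    exact realizeOn_congr _ hφ fun v hv => hγ v (hfr.1 hf hv)
  constructor
  · rintro ⟨hf, h⟩
    refine ⟨hφ, hfr.1 hf, fun A _ _ β => ?_⟩
    rw [← key hf, ← models_iff hφ hf (a := fun i => β (x i)) (fun _ => rfl)]
    exact h A _
  · rintro ⟨-, hf, h⟩
    refine ⟨hfr.2 hf, fun A _ _ a => ?_⟩
    have : Nonempty A := ⟨a ⟨0, hn⟩⟩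
    obtain ⟨β, rfl⟩ : ∃ β : ℕ → A, a = fun i => β (x i) :=
      ⟨Function.extend x a fun _ => Classical.arbitrary A, by
        funext i; rw [hx.extend_apply]⟩
    rw [models_iff hφ (hfr.2 hf) (fun _ => rfl), h A β]
    exact (key (hfr.2 hf) A β).symm

/-- Locality is used twice, in `A` and in the substructure on `X`. Since `X` contains the
`r`-neighbourhood, that neighbourhood is the same set computed in either structure. -/
theorem LocalOn.realizeOn_iff [L.IsRelational] {r : ℕ} {S : Finset ℕ} (hS : S.Nonempty)
    {φ : Formula L P} (h : LocalOn r S φ) {A : Type} [Finite A] [L.Structure A] {β : ℕ → A}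
    {X : Set A} (hX : nbhd L r S β ⊆ X) :
    φ.RealizeOn X β ↔ φ.Realize β := by
  obtain ⟨hφ, hf, h⟩ := h
  obtain ⟨γ, hγ⟩ := exists_valuation_subtype hS fun v hv => hX (mem_nbhd_self r β hv)
  let := induced L X
  have e : nbhd L r S (fun v => (γ v : A)) = nbhd L r S β := nbhd_congr r hγ
  rw [h A β, ← realizeOn_congr X hφ fun v hv => hγ v (hf hv), ← realize_induced X hφ γ, h X γ,
    realizeOn_induced X _ hφ, image_nbhd_induced X r S γ (e ▸ hX), e]
  exact realizeOn_congr _ hφ fun v hv => hγ v (hf hv)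

theorem LocalOn.mono [L.IsRelational] {r : ℕ} {S T : Finset ℕ} (hS : S.Nonempty) (hST : S ⊆ T)
    {φ : Formula L P} (h : LocalOn r S φ) : LocalOn r T φ :=
  ⟨h.1, h.2.1.trans hST, fun _ _ _ β => (h.realizeOn_iff hS (nbhd_mono r hST β)).symm⟩

theorem Formula.IsFO.and {φ ψ : Formula L P} (hφ : φ.IsFO) (hψ : ψ.IsFO) : (φ.and ψ).IsFO :=
  .neg (.or (.neg hφ) (.neg hψ))

theorem Formula.isFO_verum : (verum : Formula L P).IsFO := .ex _ (.eq _ _)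

theorem Formula.free_and (φ ψ : Formula L P) : (φ.and ψ).free = φ.free ∪ ψ.free := by
  simp [Formula.and, Formula.free]

theorem Formula.free_verum : (verum : Formula L P).free = ∅ := by
  simp [Formula.verum, Formula.free]

theorem realizeOn_and {A : Type} [L.Structure A] (X : Set A) (φ ψ : Formula L P) (β : ℕ → A) :
    (φ.and ψ).RealizeOn X β ↔ φ.RealizeOn X β ∧ ψ.RealizeOn X β := by
  simp only [Formula.and, Formula.RealizeOn]; tauto

theorem realizeOn_verum {A : Type} [L.Structure A] {X : Set A} (hX : X.Nonempty) (β : ℕ → A) :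
    (Formula.verum : Formula L P).RealizeOn X β := by
  obtain ⟨a, ha⟩ := hX
  exact ⟨a, ha, rfl⟩

theorem LocalOn.and {r : ℕ} {S : Finset ℕ} {φ ψ : Formula L P} (hφ : LocalOn r S φ)
    (hψ : LocalOn r S ψ) : LocalOn r S (φ.and ψ) :=
  ⟨hφ.1.and hψ.1, by rw [Formula.free_and]; exact Finset.union_subset hφ.2.1 hψ.2.1,
    fun A _ _ β => by rw [realize_and, realizeOn_and, hφ.2.2, hψ.2.2]⟩

theorem localOn_verum (r : ℕ) {S : Finset ℕ} (hS : S.Nonempty) :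
    LocalOn r S (Formula.verum : Formula L P) :=
  ⟨Formula.isFO_verum, by simp [Formula.free_verum], fun _ _ _ β =>
    iff_of_true (realize_verum β) (realizeOn_verum ⟨_, mem_nbhd_self r β hS.choose_spec⟩ β)⟩

/-! ### Free variables and first-orderness of the distance formulas -/

theorem Formula.isFO_bigAnd {l : List (Formula L P)} (h : ∀ φ ∈ l, φ.IsFO) :
    (bigAnd l).IsFO := by
  induction l with
  | nil => exact isFO_verum
  | cons a l ih => exact .and (h a (by simp)) (ih fun φ hφ => h φ (by simp [hφ]))

theorem Formula.isFO_bigOr {l : List (Formula L P)} (h : ∀ φ ∈ l, φ.IsFO) :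
    (bigOr l).IsFO := by
  induction l with
  | nil => exact .neg isFO_verum
  | cons a l ih => exact .or (h a (by simp)) (ih fun φ hφ => h φ (by simp [hφ]))

theorem Formula.IsFO.exMany (l : List ℕ) {φ : Formula L P} (h : φ.IsFO) :
    (exMany l φ).IsFO := by
  induction l with
  | nil => exact h
  | cons a l ih => exact .ex _ ih

theorem Formula.free_bigAnd_subset {l : List (Formula L P)} {F : Finset ℕ}
    (h : ∀ φ ∈ l, φ.free ⊆ F) : (bigAnd l).free ⊆ F := by
  induction l with
  | nil => simp [bigAnd, free_verum]
  | cons a l ih =>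
    exact (free_and a (bigAnd l)).trans_subset
      (Finset.union_subset (h a (by simp)) (ih fun φ hφ => h φ (by simp [hφ])))

theorem Formula.free_bigOr_subset {l : List (Formula L P)} {F : Finset ℕ}
    (h : ∀ φ ∈ l, φ.free ⊆ F) : (bigOr l).free ⊆ F := by
  induction l with
  | nil => simp [bigOr, free, free_verum]
  | cons a l ih =>
    simp only [bigOr, List.foldr_cons, free]
    exact Finset.union_subset (h a (by simp)) (ih fun φ hφ => h φ (by simp [hφ]))

theorem Formula.free_exMany (l : List ℕ) (φ : Formula L P) :
    (exMany l φ).free = φ.free \ l.toFinset := by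
  induction l with
  | nil => simp [exMany]
  | cons a l ih =>
    simp only [exMany, List.foldr_cons, free] at ih ⊢
    rw [ih]
    ext v; simp; tauto

theorem Formula.isFO_adj [Finite (Σ n, L.Relations n)] (x y : ℕ) :
    (adj x y : Formula L P).IsFO := by
  refine .and (.neg (.eq _ _)) (isFO_bigOr fun φ hφ => ?_)
  simp only [List.mem_flatMap, List.mem_map] at hφ
  obtain ⟨R, -, ij, -, rfl⟩ := hφ
  exact .exMany _ (.and (.rel _ _) (.and (.eq _ _) (.eq _ _)))

theorem Formula.free_adj_subset [Finite (Σ n, L.Relations n)] (x y : ℕ) :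
    (adj x y : Formula L P).free ⊆ {x, y} := by
  rw [adj, free_and]
  refine Finset.union_subset (by simp [free]) (free_bigOr_subset fun φ hφ => ?_)
  simp only [List.mem_flatMap, List.mem_map] at hφ
  obtain ⟨R, -, ij, -, rfl⟩ := hφ
  intro v
  simp only [free_exMany, free_and, free, Finset.mem_sdiff, Finset.mem_union, Finset.mem_image,
    Finset.mem_univ, true_and, Finset.mem_insert, Finset.mem_singleton, List.mem_toFinset,
    List.mem_map, List.mem_range]
  rintro ⟨h, hv⟩
  have h1 := fun e : v = x + y + 1 + (ij.1 : ℕ) => hv ⟨ij.1, ij.1.2, e.symm⟩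
  have h2 := fun e : v = x + y + 1 + (ij.2 : ℕ) => hv ⟨ij.2, ij.2.2, e.symm⟩
  have h3 := fun i : Fin R.1 => fun e : x + y + 1 + (i : ℕ) = v => hv ⟨i, i.2, e⟩
  rcases h with ⟨i, hi⟩ | h | h
  · exact (h3 i hi).elim
  · tauto
  · tauto

theorem Formula.isFO_distLE [Finite (Σ n, L.Relations n)] (r x y : ℕ) :
    (distLE r x y : Formula L P).IsFO := by
  induction r generalizing x y with
  | zero => exact .eq _ _
  | succ r ih => exact .or (ih _ _) (.ex _ (.and (ih _ _) (isFO_adj _ _)))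

theorem Formula.free_distLE_subset [Finite (Σ n, L.Relations n)] (r x y : ℕ) :
    (distLE r x y : Formula L P).free ⊆ {x, y} := by
  induction r generalizing x y with
  | zero => simp [distLE, free]
  | succ r ih =>
    simp only [distLE, free, free_and]
    refine Finset.union_subset (ih _ _) fun v hv => ?_
    simp only [Finset.mem_sdiff, Finset.mem_union, Finset.mem_singleton] at hv
    have h1 := @ih x (x + y + 1) v
    have h2 := @free_adj_subset L P _ (x + y + 1) y v
    simp only [Finset.mem_insert, Finset.mem_singleton] at h1 h2 ⊢
    tauto

theorem Formula.isFO_delta [Finite (Σ n, L.Relations n)] {n : ℕ} (G : SimpleGraph (Fin n))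
    (r : ℕ) (x : Fin n → ℕ) : (delta G r x : Formula L P).IsFO := by
  refine .and (isFO_bigAnd ?_) (isFO_bigAnd ?_) <;> rw [List.forall_mem_map]
  · exact fun _ _ => isFO_distLE _ _ _
  · exact fun _ _ => .neg (isFO_distLE _ _ _)

theorem Formula.free_delta_subset [Finite (Σ n, L.Relations n)] {n : ℕ} (G : SimpleGraph (Fin n))
    (r : ℕ) (x : Fin n → ℕ) : (delta G r x : Formula L P).free ⊆ Finset.univ.image x := by
  have h : ∀ i j, (distLE r (x i) (x j) : Formula L P).free ⊆ Finset.univ.image x := fun i j =>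
    (free_distLE_subset r _ _).trans (by simp [Finset.insert_subset_iff])
  simp only [delta, free_and]
  refine Finset.union_subset (free_bigAnd_subset ?_) (free_bigAnd_subset ?_) <;>
    rw [List.forall_mem_map]
  · exact fun _ _ => h _ _
  · exact fun _ _ => h _ _

theorem Formula.IsFO.isFOC1 {φ : Formula L P} (h : φ.IsFO) : φ.IsFOC1 := by
  induction h <;> simp_all [Formula.IsFOC1]

/-! ### Relativization -/

/-- The distance guards mention the variables in `S`, which a quantifier of `φ` might capture. Bound
variables are therefore shifted by `M`, beyond all of `S`; `ρ` records which variables have been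
shifted so far. -/
theorem exists_relativization_rename [Finite (Σ n, L.Relations n)] (r : ℕ) (S : Finset ℕ) (M : ℕ)
    (hM : ∀ v ∈ S, v < M) {φ : Formula L P} (hφ : φ.IsFO) (ρ : ℕ → ℕ)
    (hρ : ∀ v ∈ φ.free, ρ v = v + M ∨ ρ v = v ∧ v ∈ S) :
    ∃ φ' : Formula L P, φ'.IsFO ∧ φ'.free ⊆ S ∪ φ.free.image ρ ∧
      ∀ (A : Type) [L.Structure A] (β : ℕ → A),
        φ'.Realize β ↔ φ.RealizeOn (nbhd L r S β) (β ∘ ρ) := by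
  induction hφ generalizing ρ with
  | eq x y =>
    refine ⟨.eq (ρ x) (ρ y), .eq _ _, ?_, fun A _ β => Iff.rfl⟩
    intro v; simp [Formula.free]; grind
  | rel R x =>
    refine ⟨.rel R (ρ ∘ x), .rel _ _, ?_, fun A _ β => Iff.rfl⟩
    intro v; simp [Formula.free]; grind
  | neg _ ih =>
    obtain ⟨φ', h1, h2, h3⟩ := ih ρ hρ
    exact ⟨.neg φ', .neg h1, h2, fun A _ β => not_congr (h3 A β)⟩
  | or _ _ ih₁ ih₂ =>
    simp only [Formula.free, Finset.mem_union] at hρ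
    obtain ⟨φ', h1, h2, h3⟩ := ih₁ ρ fun v hv => hρ v (.inl hv)
    obtain ⟨ψ', g1, g2, g3⟩ := ih₂ ρ fun v hv => hρ v (.inr hv)
    refine ⟨.or φ' ψ', .or h1 g1, ?_, fun A _ β => or_congr (h3 A β) (g3 A β)⟩
    simp only [Formula.free, Finset.image_union]
    grind
  | @ex x φ _ ih =>
    simp only [Formula.free, Finset.mem_sdiff, Finset.mem_singleton] at hρ
    obtain ⟨φ', h1, h2, h3⟩ := ih (Function.update ρ x (x + M)) fun v hv => by
      by_cases hvx : v = x
      · subst hvx; simp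
      · rw [Function.update_of_ne hvx]; exact hρ v ⟨hv, hvx⟩
    have hxS : x + M ∉ S := fun h => by have := hM _ h; omega
    refine ⟨.ex (x + M) (.and (.bigOr (S.toList.map fun i => .distLE r i (x + M))) φ'),
      .ex _ (.and (Formula.isFO_bigOr ?_) h1), ?_, fun A _ β => ?_⟩
    · rw [List.forall_mem_map]; exact fun _ _ => Formula.isFO_distLE _ _ _
    · have h4 : (Formula.bigOr (S.toList.map fun i => .distLE r i (x + M)) : Formula L P).free ⊆
          insert (x + M) S := by
        refine Formula.free_bigOr_subset ?_
        rw [List.forall_mem_map]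
        intro i hi
        refine (Formula.free_distLE_subset r _ _).trans ?_
        rw [Finset.mem_toList] at hi
        intro v; simp only [Finset.mem_insert, Finset.mem_singleton]; grind
      intro v hv
      simp only [Formula.free, Formula.free_and, Finset.mem_sdiff, Finset.mem_union,
        Finset.mem_singleton] at hv
      obtain ⟨hv | hv, hne⟩ := hv
      · have := h4 hv
        simp only [Finset.mem_insert] at this
        exact Finset.mem_union_left _ (this.resolve_left hne)
      · rcases Finset.mem_union.1 (h2 hv) with h | h
        · exact Finset.mem_union_left _ h
        · obtain ⟨t, ht, rfl⟩ := Finset.mem_image.1 h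
          by_cases htx : t = x
          · subst htx; simp at hne
          · rw [Function.update_of_ne htx]
            exact Finset.mem_union_right _
              (Finset.mem_image_of_mem _ (by simp [Formula.free, ht, htx]))
    · simp only [Formula.Realize, Formula.RealizeOn, realize_and, realize_bigOr, List.mem_map,
        Finset.mem_toList]
      refine exists_congr fun a => ?_
      have e : nbhd L r S (Function.update β (x + M) a) = nbhd L r S β :=
        nbhd_congr r fun v hv => Function.update_of_ne (ne_of_mem_of_not_mem hv hxS) _ _
      refine and_congr ?_ ?_
      · rw [← e]
        constructor
        · rintro ⟨_, ⟨i, hi, rfl⟩, h⟩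
          rw [realize_distLE] at h
          exact ⟨i, hi, by simpa using h⟩
        · rintro ⟨i, hi, h⟩
          refine ⟨_, ⟨i, hi, rfl⟩, ?_⟩
          rw [realize_distLE]
          simpa using h
      · rw [h3, e]
        refine realizeOn_congr _ ‹_› fun v hv => ?_
        by_cases hvx : v = x
        · subst hvx; simp
        · have : ρ v ≠ x + M := by
            rcases hρ v ⟨hv, hvx⟩ with h | ⟨h, h'⟩
            · omega
            · have := hM v h'; omega
          simp [Function.update_of_ne hvx, Function.update_of_ne this]

/-- The relativization of a first-order formula to the `r`-neighbourhood of its variables. -/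
theorem exists_localOn_relativization [L.IsRelational] [Finite (Σ n, L.Relations n)] (r : ℕ)
    {S : Finset ℕ} (hS : S.Nonempty) {φ : Formula L P} (hφ : φ.IsFO) (hf : φ.free ⊆ S) :
    ∃ φ' : Formula L P, LocalOn r S φ' ∧
      ∀ (A : Type) [L.Structure A] (β : ℕ → A),
        φ'.Realize β ↔ φ.RealizeOn (nbhd L r S β) β := by
  obtain ⟨φ', h1, h2, h3⟩ := exists_relativization_rename r S (S.sup id + 1)
    (fun v hv => Nat.lt_succ_of_le (Finset.le_sup (f := id) hv)) hφ id
    (fun v hv => .inr ⟨rfl, hf hv⟩)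
  have hf' : φ'.free ⊆ S := h2.trans (Finset.union_subset subset_rfl (by simpa using hf))
  refine ⟨φ', ⟨h1, hf', fun A _ _ β => ?_⟩, h3⟩
  -- Locality of `φ'` follows by applying its defining property `h3` a second time, in the
  -- substructure on the neighbourhood: there too it relativizes `φ` to the same set.
  obtain ⟨γ, hγ⟩ := exists_valuation_subtype hS fun v hv => mem_nbhd_self (L := L) r β hv
  let := induced L (nbhd L r S β)
  have e : nbhd L r S (fun v => (γ v : A)) = nbhd L r S β := nbhd_congr r hγ
  rw [h3 A β, ← realizeOn_congr _ h1 fun v hv => hγ v (hf' hv), ← realize_induced _ h1 γ, h3,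
    realizeOn_induced _ _ hφ, image_nbhd_induced _ r S γ e.subset, e]
  exact (realizeOn_congr _ hφ fun v hv => hγ v (hf hv)).symm

/-! ### Decomposition of first-order formulas over disjoint unions -/

/-- A pair of first-order formulas with free variables in `F₁` and `F₂`. -/
def IsFOPair (F₁ F₂ : Finset ℕ) (p : Formula L P × Formula L P) : Prop :=
  (p.1.IsFO ∧ p.1.free ⊆ F₁) ∧ p.2.IsFO ∧ p.2.free ⊆ F₂

/-- De Morgan followed by distributivity: each pair contributes a choice of which component to
negate. Nonemptiness of both sets makes `verum` true in the base case. -/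
theorem exists_neg_pairs {F₁ F₂ : Finset ℕ} (l : List (Formula L P × Formula L P))
    (hl : ∀ p ∈ l, IsFOPair F₁ F₂ p) :
    ∃ l' : List (Formula L P × Formula L P), (∀ p ∈ l', IsFOPair F₁ F₂ p) ∧
      ∀ (A : Type) [L.Structure A] (X₁ X₂ : Set A), X₁.Nonempty → X₂.Nonempty → ∀ β : ℕ → A,
        (¬ ∃ p ∈ l, p.1.RealizeOn X₁ β ∧ p.2.RealizeOn X₂ β) ↔
          ∃ p ∈ l', p.1.RealizeOn X₁ β ∧ p.2.RealizeOn X₂ β := by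
  induction l with
  | nil =>
    refine ⟨[(.verum, .verum)], ?_, fun A _ X₁ X₂ h1 h2 β => ?_⟩
    · simp [IsFOPair, Formula.isFO_verum, Formula.free_verum]
    · simp [realizeOn_verum, h1, h2]
  | cons p l ih =>
    obtain ⟨l', h1, h2⟩ := ih fun q hq => hl q (by simp [hq])
    have hp := hl p (by simp)
    refine ⟨l'.map (fun q => (.and (.neg p.1) q.1, q.2)) ++
      l'.map (fun q => (q.1, .and (.neg p.2) q.2)), ?_, fun A _ X₁ X₂ h3 h4 β => ?_⟩
    · simp only [List.mem_append, List.mem_map]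
      rintro _ (⟨q, hq, rfl⟩ | ⟨q, hq, rfl⟩)
      · have hq := h1 q hq
        exact ⟨⟨.and (.neg hp.1.1) hq.1.1, by
          rw [Formula.free_and]; exact Finset.union_subset hp.1.2 hq.1.2⟩, hq.2⟩
      · have hq := h1 q hq
        exact ⟨hq.1, .and (.neg hp.2.1) hq.2.1, by
          rw [Formula.free_and]; exact Finset.union_subset hp.2.2 hq.2.2⟩
    · have := h2 A X₁ X₂ h3 h4 β
      simp only [List.mem_cons, exists_eq_left, not_or, this, List.mem_append, List.mem_map,
        or_and_right, exists_or, exists_exists_and_eq_and, realizeOn_and, Formula.RealizeOn]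
      rw [not_and_or, or_and_right, ← exists_and_left, ← exists_and_left]
      refine or_congr (exists_congr fun q => ?_) (exists_congr fun q => ?_) <;> tauto

/-- The Feferman–Vaught theorem for a disjoint union without relations across. The colouring `c`
says in which part each free variable lives; at a quantifier both colours of the bound variable are
tried. Atoms mixing the two colours are false, which gives the empty list. -/
theorem exists_split_pairs {φ : Formula L P} (hφ : φ.IsFO) (c : ℕ → Bool) :
    ∃ l : List (Formula L P × Formula L P),
      (∀ p ∈ l, IsFOPair (φ.free.filter (c · = true)) (φ.free.filter (c · = false)) p) ∧
      ∀ (A : Type) [L.Structure A] (X₁ X₂ : Set A), X₁.Nonempty → X₂.Nonempty → Disjoint X₁ X₂ →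
        (∀ (n : ℕ) (R : L.Relations n) (a : Fin n → A),
          FirstOrder.Language.Structure.RelMap R a → ∀ i j, a i ∈ X₁ → a j ∉ X₂) →
        ∀ β : ℕ → A, (∀ v ∈ φ.free, β v ∈ bif c v then X₁ else X₂) →
          (φ.RealizeOn (X₁ ∪ X₂) β ↔ ∃ p ∈ l, p.1.RealizeOn X₁ β ∧ p.2.RealizeOn X₂ β) := by
  induction hφ generalizing c with
  | eq x y =>
    rcases hx : c x with _ | _ <;> rcases hy : c y with _ | _
    · refine ⟨[(.verum, .eq x y)], ?_, fun A _ X₁ X₂ h1 h2 hd hR β hβ => ?_⟩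
      · simp [IsFOPair, Formula.isFO_verum, Formula.free_verum, Formula.IsFO.eq, Formula.free,
          Finset.insert_subset_iff, hx, hy]
      · simp [Formula.RealizeOn, realizeOn_verum h1]
    · refine ⟨[], by simp, fun A _ X₁ X₂ h1 h2 hd hR β hβ => ?_⟩
      have h3 := hβ x (by simp [Formula.free])
      have h4 := hβ y (by simp [Formula.free])
      simp only [hx, hy, cond_true, cond_false] at h3 h4
      simp only [Formula.RealizeOn, List.not_mem_nil, false_and, exists_false, iff_false]
      exact fun e => Set.disjoint_left.1 hd h4 (e ▸ h3)
    · refine ⟨[], by simp, fun A _ X₁ X₂ h1 h2 hd hR β hβ => ?_⟩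
      have h3 := hβ x (by simp [Formula.free])
      have h4 := hβ y (by simp [Formula.free])
      simp only [hx, hy, cond_true, cond_false] at h3 h4
      simp only [Formula.RealizeOn, List.not_mem_nil, false_and, exists_false, iff_false]
      exact fun e => Set.disjoint_left.1 hd h3 (e ▸ h4)
    · refine ⟨[(.eq x y, .verum)], ?_, fun A _ X₁ X₂ h1 h2 hd hR β hβ => ?_⟩
      · simp [IsFOPair, Formula.isFO_verum, Formula.free_verum, Formula.IsFO.eq, Formula.free,
          Finset.insert_subset_iff, hx, hy]
      · simp [Formula.RealizeOn, realizeOn_verum h2]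
  | rel R x =>
    -- A nullary relation satisfies this vacuously and goes to the first component; relativization
    -- does not affect its truth value.
    by_cases ht : ∀ i, c (x i) = true
    · refine ⟨[(.rel R x, .verum)], ?_, fun A _ X₁ X₂ h1 h2 hd hR β hβ => ?_⟩
      · simp [IsFOPair, Formula.isFO_verum, Formula.free_verum, Formula.IsFO.rel, Formula.free,
          Finset.subset_iff, ht]
      · simp [Formula.RealizeOn, realizeOn_verum h2]
    by_cases hf : ∀ i, c (x i) = false
    · refine ⟨[(.verum, .rel R x)], ?_, fun A _ X₁ X₂ h1 h2 hd hR β hβ => ?_⟩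
      · simp [IsFOPair, Formula.isFO_verum, Formula.free_verum, Formula.IsFO.rel, Formula.free,
          Finset.subset_iff, hf]
      · simp [Formula.RealizeOn, realizeOn_verum h1]
    · refine ⟨[], by simp, fun A _ X₁ X₂ h1 h2 hd hR β hβ => ?_⟩
      simp only [Formula.RealizeOn, List.not_mem_nil, false_and, exists_false, iff_false]
      intro h
      push Not at ht hf
      obtain ⟨i, hi⟩ := ht
      obtain ⟨j, hj⟩ := hf
      have h3 := hβ (x i) (by simp [Formula.free])
      have h4 := hβ (x j) (by simp [Formula.free])
      simp only [Bool.not_eq_true, Bool.not_eq_false] at hi hj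
      simp only [hi, hj, cond_true, cond_false] at h3 h4
      exact hR _ R _ h j i h4 h3
  | neg _ ih =>
    obtain ⟨l, h1, h2⟩ := ih c
    obtain ⟨l', h3, h4⟩ := exists_neg_pairs l h1
    refine ⟨l', h3, fun A _ X₁ X₂ n1 n2 hd hR β hβ => ?_⟩
    rw [← h4 A X₁ X₂ n1 n2 β]
    exact not_congr (h2 A X₁ X₂ n1 n2 hd hR β hβ)
  | or _ _ ih₁ ih₂ =>
    obtain ⟨l, h1, h2⟩ := ih₁ c
    obtain ⟨l', h3, h4⟩ := ih₂ c
    refine ⟨l ++ l', ?_, fun A _ X₁ X₂ n1 n2 hd hR β hβ => ?_⟩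
    · simp only [List.mem_append, Formula.free, Finset.filter_union]
      rintro p (hp | hp)
      · exact ⟨⟨(h1 p hp).1.1, (h1 p hp).1.2.trans Finset.subset_union_left⟩,
          (h1 p hp).2.1, (h1 p hp).2.2.trans Finset.subset_union_left⟩
      · exact ⟨⟨(h3 p hp).1.1, (h3 p hp).1.2.trans Finset.subset_union_right⟩,
          (h3 p hp).2.1, (h3 p hp).2.2.trans Finset.subset_union_right⟩
    · simp only [Formula.free, Finset.mem_union] at hβ
      simp only [Formula.RealizeOn, List.mem_append, or_and_right, exists_or]
      exact or_congr (h2 A X₁ X₂ n1 n2 hd hR β fun v hv => hβ v (.inl hv))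
        (h4 A X₁ X₂ n1 n2 hd hR β fun v hv => hβ v (.inr hv))
  | @ex x φ hφ ih =>
    obtain ⟨l, h1, h2⟩ := ih (Function.update c x true)
    obtain ⟨l', h3, h4⟩ := ih (Function.update c x false)
    refine ⟨l.map (fun p => (.ex x p.1, p.2)) ++ l'.map (fun p => (p.1, .ex x p.2)), ?_,
      fun A _ X₁ X₂ n1 n2 hd hR β hβ => ?_⟩
    · simp only [List.mem_append, List.mem_map, Formula.free]
      rintro _ (⟨p, hp, rfl⟩ | ⟨p, hp, rfl⟩)
      · obtain ⟨⟨a1, a2⟩, a3, a4⟩ := h1 p hp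
        refine ⟨⟨.ex _ a1, fun v hv => ?_⟩, a3, fun v hv => ?_⟩
        · simp only [Formula.free, Finset.mem_sdiff, Finset.mem_singleton] at hv
          have := a2 hv.1
          simp only [Finset.mem_filter, Finset.mem_sdiff, Finset.mem_singleton,
            Function.update_of_ne hv.2] at this ⊢
          exact ⟨⟨this.1, hv.2⟩, this.2⟩
        · have := a4 hv
          simp only [Finset.mem_filter, Finset.mem_sdiff, Finset.mem_singleton] at this ⊢
          have hvx : v ≠ x := by rintro rfl; simp at this
          rw [Function.update_of_ne hvx] at this
          exact ⟨⟨this.1, hvx⟩, this.2⟩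
      · obtain ⟨⟨a1, a2⟩, a3, a4⟩ := h3 p hp
        refine ⟨⟨a1, fun v hv => ?_⟩, .ex _ a3, fun v hv => ?_⟩
        · have := a2 hv
          simp only [Finset.mem_filter, Finset.mem_sdiff, Finset.mem_singleton] at this ⊢
          have hvx : v ≠ x := by rintro rfl; simp at this
          rw [Function.update_of_ne hvx] at this
          exact ⟨⟨this.1, hvx⟩, this.2⟩
        · simp only [Formula.free, Finset.mem_sdiff, Finset.mem_singleton] at hv
          have := a4 hv.1
          simp only [Finset.mem_filter, Finset.mem_sdiff, Finset.mem_singleton,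
            Function.update_of_ne hv.2] at this ⊢
          exact ⟨⟨this.1, hv.2⟩, this.2⟩
    · have hupd : ∀ (b : Bool) (a : A), a ∈ (bif b then X₁ else X₂) → ∀ v ∈ φ.free,
          Function.update β x a v ∈ bif Function.update c x b v then X₁ else X₂ := by
        intro b a ha v hv
        by_cases hvx : v = x
        · subst hvx; simpa using ha
        · rw [Function.update_of_ne hvx, Function.update_of_ne hvx]
          exact hβ v (by simp [Formula.free, hv, hvx])
      -- With `x` coloured for the first part, it is not free in the second component, so the
      -- quantifier can be pulled into the first one.
      have hl : ∀ a, a ∈ X₁ → (φ.RealizeOn (X₁ ∪ X₂) (Function.update β x a) ↔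
          ∃ p ∈ l, p.1.RealizeOn X₁ (Function.update β x a) ∧ p.2.RealizeOn X₂ β) := by
        intro a ha
        rw [h2 A X₁ X₂ n1 n2 hd hR _ (hupd true a ha)]
        refine exists_congr fun p => and_congr_right fun hp => and_congr_right fun _ => ?_
        refine realizeOn_congr _ (h1 p hp).2.1 fun v hv => Function.update_of_ne ?_ _ _
        rintro rfl
        simpa using (h1 p hp).2.2 hv
      have hl' : ∀ a, a ∈ X₂ → (φ.RealizeOn (X₁ ∪ X₂) (Function.update β x a) ↔
          ∃ p ∈ l', p.1.RealizeOn X₁ β ∧ p.2.RealizeOn X₂ (Function.update β x a)) := by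
        intro a ha
        rw [h4 A X₁ X₂ n1 n2 hd hR _ (hupd false a ha)]
        refine exists_congr fun p => and_congr_right fun hp => and_congr_left fun _ => ?_
        refine realizeOn_congr _ (h3 p hp).1.1 fun v hv => Function.update_of_ne ?_ _ _
        rintro rfl
        simpa using (h3 p hp).1.2 hv
      simp only [Formula.RealizeOn, List.mem_append, List.mem_map, or_and_right, exists_or,
        exists_exists_and_eq_and, Set.mem_union]
      refine or_congr ?_ ?_
      · refine (exists_congr fun a => and_congr_right fun ha => hl a ha).trans ?_
        constructor
        · rintro ⟨a, ha, p, hp, q1, q2⟩; exact ⟨p, hp, ⟨a, ha, q1⟩, q2⟩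
        · rintro ⟨p, hp, ⟨a, ha, q1⟩, q2⟩; exact ⟨a, ha, p, hp, q1, q2⟩
      · refine (exists_congr fun a => and_congr_right fun ha => hl' a ha).trans ?_
        constructor
        · rintro ⟨a, ha, p, hp, q1, q2⟩; exact ⟨p, hp, q1, ⟨a, ha, q2⟩⟩
        · rintro ⟨p, hp, q1, ⟨a, ha, q2⟩⟩; exact ⟨a, ha, p, hp, q1, q2⟩

/-- Two neighbourhoods of radius `r` whose centres are at distance more than `2r + 1` are not
connected by an edge of the Gaifman graph, nor do they meet. -/
theorem ne_and_not_adj_of_far {A : Type} [L.Structure A] {r : ℕ} {S₁ S₂ : Finset ℕ} {β : ℕ → A}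
    (h : ∀ i ∈ S₁, ∀ j ∈ S₂, ¬ (gaifman L A).edist (β i) (β j) ≤ (2 * r + 1 : ℕ)) {a b : A}
    (ha : a ∈ nbhd L r S₁ β) (hb : b ∈ nbhd L r S₂ β) : a ≠ b ∧ ¬ (gaifman L A).Adj a b := by
  obtain ⟨i, hi, hia⟩ := ha
  obtain ⟨j, hj, hjb⟩ := hb
  rw [SimpleGraph.edist_comm] at hjb
  have key : ¬ (gaifman L A).edist a b ≤ 1 := fun hab => h i hi j hj <| by
    calc (gaifman L A).edist (β i) (β j)
        ≤ (gaifman L A).edist (β i) a + (gaifman L A).edist a (β j) := SimpleGraph.edist_triangle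
      _ ≤ (gaifman L A).edist (β i) a + ((gaifman L A).edist a b + (gaifman L A).edist b (β j)) := by
        gcongr; exact SimpleGraph.edist_triangle
      _ ≤ r + (1 + r) := by gcongr
      _ = (2 * r + 1 : ℕ) := by push_cast; ring
  exact ⟨fun e => key (by simp [e]), fun e => key (SimpleGraph.edist_eq_one_iff_adj.2 e).le⟩

/-- A local formula around `S₁ ∪ S₂` splits into local formulas around `S₁` and `S₂` on tuples for
which these two parts are far from each other. -/
theorem LocalOn.exists_split [L.IsRelational] [Finite (Σ n, L.Relations n)] {r : ℕ}
    {S₁ S₂ : Finset ℕ} (h₁ : S₁.Nonempty) (h₂ : S₂.Nonempty)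
    {φ : Formula L P} (hφ : LocalOn r (S₁ ∪ S₂) φ) :
    ∃ l : List (Formula L P × Formula L P),
      (∀ p ∈ l, LocalOn r S₁ p.1 ∧ LocalOn r S₂ p.2) ∧
      ∀ (A : Type) [Finite A] [L.Structure A] (β : ℕ → A),
        (∀ i ∈ S₁, ∀ j ∈ S₂, ¬ (gaifman L A).edist (β i) (β j) ≤ (2 * r + 1 : ℕ)) →
        (φ.Realize β ↔ ∃ p ∈ l, p.1.Realize β ∧ p.2.Realize β) := by
  obtain ⟨hfo, hfree, hloc⟩ := hφ
  obtain ⟨l, hl, hsplit⟩ := exists_split_pairs hfo fun v => decide (v ∈ S₁)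
  have h1 : φ.free.filter (fun v => decide (v ∈ S₁) = true) ⊆ S₁ := by
    intro v; simp
  have h2 : φ.free.filter (fun v => decide (v ∈ S₁) = false) ⊆ S₂ := by
    intro v hv
    simp only [decide_eq_false_iff_not, Finset.mem_filter] at hv
    exact (Finset.mem_union.1 (hfree hv.1)).resolve_left hv.2
  have ex : ∀ p : Formula L P × Formula L P, ∃ q : Formula L P × Formula L P, p ∈ l →
      (LocalOn r S₁ q.1 ∧ LocalOn r S₂ q.2) ∧ ∀ (A : Type) [L.Structure A] (β : ℕ → A),
        (q.1.Realize β ↔ p.1.RealizeOn (nbhd L r S₁ β) β) ∧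
        (q.2.Realize β ↔ p.2.RealizeOn (nbhd L r S₂ β) β) := by
    intro p
    by_cases hp : p ∈ l
    · obtain ⟨⟨a1, a2⟩, a3, a4⟩ := hl p hp
      obtain ⟨q₁, b1, b2⟩ := exists_localOn_relativization r h₁ a1 (a2.trans h1)
      obtain ⟨q₂, c1, c2⟩ := exists_localOn_relativization r h₂ a3 (a4.trans h2)
      exact ⟨(q₁, q₂), fun _ => ⟨⟨b1, c1⟩, fun A _ β => ⟨b2 A β, c2 A β⟩⟩⟩
    · exact ⟨p, fun h => (hp h).elim⟩
  choose f hf using ex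
  refine ⟨l.map f, ?_, fun A _ _ β hfar => ?_⟩
  · rw [List.forall_mem_map]; exact fun p hp => (hf p hp).1
  · have hne := fun a b => @ne_and_not_adj_of_far L A _ r S₁ S₂ β hfar a b
    rw [hloc, nbhd_union, hsplit A _ _ ⟨_, mem_nbhd_self r β h₁.choose_spec⟩
      ⟨_, mem_nbhd_self r β h₂.choose_spec⟩]
    · simp only [List.mem_map, exists_exists_and_eq_and]
      exact exists_congr fun p => and_congr_right fun hp =>
        and_congr ((hf p hp).2 A β).1.symm ((hf p hp).2 A β).2.symm
    · exact Set.disjoint_left.2 fun a ha hb => (hne a a ha hb).1 rfl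
    · intro n R a hR i j hi hj
      obtain ⟨g1, g2⟩ := hne _ _ hi hj
      exact g2 ⟨g1, n, R, a, hR, ⟨i, rfl⟩, ⟨j, rfl⟩⟩
    · intro v hv
      by_cases hv1 : v ∈ S₁
      · simpa [hv1] using mem_nbhd_self r β hv1
      · simpa [hv1] using
          mem_nbhd_self (L := L) r β ((Finset.mem_union.1 (hfree hv)).resolve_left hv1)

/-! ### Counting valuations -/

/-- The number of valuations that satisfy `Q` and differ from `β` at most on `T`. -/
noncomputable def cnt {A : Type} (T : Finset ℕ) (β : ℕ → A) (Q : (ℕ → A) → Prop) : ℤ :=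
  ({γ | (∀ v ∉ T, γ v = β v) ∧ Q γ}.ncard : ℤ)

theorem finite_valuations {A : Type} [Finite A] (T : Finset ℕ) (β : ℕ → A)
    (Q : (ℕ → A) → Prop) : {γ | (∀ v ∉ T, γ v = β v) ∧ Q γ}.Finite := by
  refine Set.Finite.of_injOn (f := fun γ (i : T) => γ i) (t := Set.univ) (fun _ _ => trivial)
    (fun γ hγ γ' hγ' h => funext fun v => ?_) Set.finite_univ
  by_cases hv : v ∈ T
  · exact congrFun h ⟨v, hv⟩
  · rw [hγ.1 v hv, hγ'.1 v hv]

theorem cnt_congr {A : Type} (T : Finset ℕ) (β : ℕ → A) {Q Q' : (ℕ → A) → Prop}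
    (h : ∀ γ, Q γ ↔ Q' γ) : cnt T β Q = cnt T β Q' := by
  simp only [cnt, h]

theorem cnt_false {A : Type} (T : Finset ℕ) (β : ℕ → A) : cnt T β (fun _ => False) = 0 := by
  simp [cnt]

theorem cnt_or {A : Type} [Finite A] (T : Finset ℕ) (β : ℕ → A) (Q Q' : (ℕ → A) → Prop) :
    cnt T β (fun γ => Q γ ∨ Q' γ) = cnt T β Q + cnt T β Q' - cnt T β (fun γ => Q γ ∧ Q' γ) := by
  have h := Set.ncard_union_add_ncard_inter _ _ (finite_valuations T β Q) (finite_valuations T β Q')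
  rw [eq_sub_iff_add_eq]
  simp only [cnt]
  norm_cast
  convert h using 3 <;> (ext γ; simp; tauto)

theorem cnt_eq_sum_fiber {A κ : Type} [Finite A] (T : Finset ℕ) (β : ℕ → A)
    (Q : (ℕ → A) → Prop) (f : (ℕ → A) → κ) (s : Finset κ) (hf : ∀ γ, f γ ∈ s) :
    cnt T β Q = ∑ e ∈ s, cnt T β (fun γ => Q γ ∧ f γ = e) := by
  classical
  simp only [cnt]
  rw [Set.ncard_eq_toFinset_card _ (finite_valuations T β Q),
    Finset.card_eq_sum_card_fiberwise (f := f) (t := s) (fun γ _ => hf γ)]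
  push_cast
  refine Finset.sum_congr rfl fun e _ => ?_
  rw [Set.ncard_eq_toFinset_card _ (finite_valuations T β _)]
  congr 2
  ext γ
  simp [and_assoc]

theorem cnt_mul {A : Type} (T₁ T₂ : Finset ℕ) (hT : Disjoint T₁ T₂) (β : ℕ → A)
    (Q₁ Q₂ : (ℕ → A) → Prop)
    (h₁ : ∀ γ γ', (∀ v ∉ T₂, γ v = γ' v) → Q₁ γ → Q₁ γ')
    (h₂ : ∀ γ γ', (∀ v ∉ T₁, γ v = γ' v) → Q₂ γ → Q₂ γ') :
    cnt (T₁ ∪ T₂) β (fun γ => Q₁ γ ∧ Q₂ γ) = cnt T₁ β Q₁ * cnt T₂ β Q₂ := by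
  simp only [cnt]
  norm_cast
  rw [← Set.ncard_prod]
  symm
  refine Set.ncard_congr (fun p _ v => if v ∈ T₁ then p.1 v else p.2 v) ?_ ?_ ?_
  · rintro ⟨γ₁, γ₂⟩ ⟨⟨a1, a2⟩, ⟨b1, b2⟩⟩
    dsimp only at *
    refine ⟨fun v hv => ?_, h₁ γ₁ _ (fun v hv => ?_) a2, h₂ γ₂ _ (fun v hv => ?_) b2⟩
    · simp only [Finset.mem_union, not_or] at hv
      simp [hv.1, b1 v hv.2]
    · by_cases hv1 : v ∈ T₁
      · simp [hv1]
      · simp [hv1, a1 v hv1, b1 v hv]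
    · simp [hv]
  · rintro ⟨γ₁, γ₂⟩ ⟨γ₁', γ₂'⟩ ⟨⟨a1, a2⟩, ⟨b1, b2⟩⟩ ⟨⟨c1, c2⟩, ⟨d1, d2⟩⟩ h
    dsimp only at *
    refine Prod.ext (funext fun v => ?_) (funext fun v => ?_)
    · have := congrFun h v
      by_cases hv : v ∈ T₁
      · simpa [hv] using this
      · simp [a1 v hv, c1 v hv]
    · have := congrFun h v
      by_cases hv : v ∈ T₁
      · have hv2 := Finset.disjoint_left.1 hT hv
        simp [b1 v hv2, d1 v hv2]
      · simpa [hv] using this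
  · rintro γ ⟨a1, a2, a3⟩
    refine ⟨(fun v => if v ∈ T₁ then γ v else β v, fun v => if v ∈ T₂ then γ v else β v),
      ⟨⟨fun v hv => by simp [hv], h₁ γ _ (fun v hv => ?_) a2⟩,
        ⟨fun v hv => by simp [hv], h₂ γ _ (fun v hv => ?_) a3⟩⟩, funext fun v => ?_⟩
    · by_cases hv1 : v ∈ T₁
      · simp [hv1]
      · simp [hv1, a1 v (by simp [hv, hv1])]
    · by_cases hv1 : v ∈ T₂
      · simp [hv1]
      · simp [hv1, a1 v (by simp [hv, hv1])]
    · by_cases hv1 : v ∈ T₁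
      · simp [hv1]
      · by_cases hv2 : v ∈ T₂
        · simp [hv1, hv2]
        · simp [hv1, hv2, a1 v (by simp [hv1, hv2])]

/-- Counting valuations instead of tuples lets the set of counted variables be split without
reindexing. -/
theorem eval_count {A : Type} [L.Structure A] {n : ℕ} (x : Fin n ↪ ℕ) (φ : Formula L P)
    (β : ℕ → A) :
    (Term.count x φ).eval β = cnt (Finset.univ.image x) β (fun γ => φ.Realize γ) := by
  simp only [Term.eval, cnt, ← Nat.card_coe_set_eq]
  congr 1
  refine Nat.card_congr (Equiv.ofBijective
    (fun a => ⟨Function.extend x a.1 β, fun v hv => ?_, a.2⟩) ⟨?_, ?_⟩)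
  · exact Function.extend_apply' _ _ _ fun ⟨i, hi⟩ => hv (by simp [← hi])
  · intro a b h
    refine Subtype.ext (funext fun i => ?_)
    have := congrFun (congrArg Subtype.val h) (x i)
    simpa [x.injective.extend_apply] using this
  · rintro ⟨γ, h1, h2⟩
    have e : Function.extend x (fun i => γ (x i)) β = γ := by
      funext v
      by_cases hv : ∃ i, x i = v
      · obtain ⟨i, rfl⟩ := hv
        rw [x.injective.extend_apply]
      · rw [Function.extend_apply' _ _ _ hv, h1 v (by simpa using hv)]
    exact ⟨⟨fun i => γ (x i), e.symm ▸ h2⟩, Subtype.ext e⟩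

/-! ### Distance configurations -/

/-- Among the values of variables in `S`, exactly those joined by an edge of `G` are at distance at
most `R`. -/
def Config (L : FirstOrder.Language.{0, 0}) {A : Type} [L.Structure A] (R : ℕ) (S : Finset ℕ)
    (G : SimpleGraph ℕ) (β : ℕ → A) : Prop :=
  ∀ i ∈ S, ∀ j ∈ S, i ≠ j → (G.Adj i j ↔ (gaifman L A).edist (β i) (β j) ≤ R)

theorem Config.congr {A : Type} [L.Structure A] {R : ℕ} {S : Finset ℕ} {G : SimpleGraph ℕ}
    {β β' : ℕ → A} (h : ∀ v ∈ S, β v = β' v) (hc : Config L R S G β) : Config L R S G β' :=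
  fun i hi j hj hij => by rw [← h i hi, ← h j hj]; exact hc i hi j hj hij

theorem realize_delta_comap [Finite (Σ n, L.Relations n)] {A : Type} [L.Structure A] {n R : ℕ}
    (G : SimpleGraph ℕ) {e : Fin n → ℕ} (he : Function.Injective e) (β : ℕ → A) :
    (Formula.delta (G.comap e) R e : Formula L P).Realize β ↔
      Config L R (Finset.univ.image e) G β := by
  rw [realize_delta]
  simp only [Config, Finset.mem_image, Finset.mem_univ, true_and, forall_exists_index,
    forall_apply_eq_imp_iff, SimpleGraph.comap_adj, he.ne_iff]

/-- The graph `G` together with the edges in `E`. -/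
def addEdges (G : SimpleGraph ℕ) (E : Finset (ℕ × ℕ)) : SimpleGraph ℕ :=
  G ⊔ SimpleGraph.fromRel fun i j => (i, j) ∈ E

theorem addEdges_adj {G : SimpleGraph ℕ} {E : Finset (ℕ × ℕ)} {i j : ℕ} :
    (addEdges G E).Adj i j ↔ G.Adj i j ∨ i ≠ j ∧ ((i, j) ∈ E ∨ (j, i) ∈ E) := by
  simp [addEdges]

open Classical in
/-- The pairs in `S₁ × S₂` whose values are at distance at most `R`. -/
noncomputable def closePairs (L : FirstOrder.Language.{0, 0}) {A : Type} [L.Structure A] (R : ℕ)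
    (S₁ S₂ : Finset ℕ) (β : ℕ → A) : Finset (ℕ × ℕ) :=
  (S₁ ×ˢ S₂).filter fun p => (gaifman L A).edist (β p.1) (β p.2) ≤ R

/-- The internal configurations of the parts and the set of close cross pairs determine the whole
configuration. Hence the fibres of `closePairs` are again configuration counts. -/
theorem config_addEdges_iff {A : Type} [L.Structure A] {R : ℕ} {S₁ S₂ : Finset ℕ}
    (hd : Disjoint S₁ S₂) {G : SimpleGraph ℕ} (hG : ∀ i ∈ S₁, ∀ j ∈ S₂, ¬ G.Adj i j)
    {E : Finset (ℕ × ℕ)} (hE : E ⊆ S₁ ×ˢ S₂) (β : ℕ → A) :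
    Config L R (S₁ ∪ S₂) (addEdges G E) β ↔
      Config L R S₁ G β ∧ Config L R S₂ G β ∧ closePairs L R S₁ S₂ β = E := by
  have hd1 : ∀ i ∈ S₁, i ∉ S₂ := fun i => fun h => Finset.disjoint_left.1 hd h
  have hE1 : ∀ i j, (i, j) ∈ E → i ∈ S₁ ∧ j ∈ S₂ := fun i j h => Finset.mem_product.1 (hE h)
  constructor
  · intro h
    refine ⟨fun i hi j hj hij => ?_, fun i hi j hj hij => ?_, ?_⟩
    · rw [← h i (Finset.mem_union_left _ hi) j (Finset.mem_union_left _ hj) hij, addEdges_adj]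
      have := hE1 i j; have := hE1 j i; have := hd1 i; have := hd1 j; tauto
    · rw [← h i (Finset.mem_union_right _ hi) j (Finset.mem_union_right _ hj) hij, addEdges_adj]
      have := hE1 i j; have := hE1 j i; have := hd1 i; have := hd1 j; tauto
    · ext ⟨i, j⟩
      simp only [closePairs, Finset.mem_filter, Finset.mem_product]
      by_cases hij : i ∈ S₁ ∧ j ∈ S₂
      · have hne : i ≠ j := fun e => hd1 i hij.1 (e ▸ hij.2)
        rw [← h i (Finset.mem_union_left _ hij.1) j (Finset.mem_union_right _ hij.2) hne,
          addEdges_adj]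
        have := hG i hij.1 j hij.2
        have := hE1 j i; have := hd1 i; have := hd1 j; tauto
      · have := hE1 i j; tauto
  · rintro ⟨h1, h2, rfl⟩
    have key : ∀ i ∈ S₁, ∀ j ∈ S₂, ((addEdges G (closePairs L R S₁ S₂ β)).Adj i j ↔
        (gaifman L A).edist (β i) (β j) ≤ R) := by
      intro i hi j hj
      rw [addEdges_adj]
      have hne : i ≠ j := fun e => hd1 i hi (e ▸ hj)
      simp [hG i hi j hj, hne, closePairs, hi, hj, hd1 i hi]
    intro i hi j hj hij
    rcases Finset.mem_union.1 hi with hi | hi <;> rcases Finset.mem_union.1 hj with hj | hj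
    · rw [← h1 i hi j hj hij, addEdges_adj]
      have := hE1 i j; have := hE1 j i; have := hd1 i; have := hd1 j; tauto
    · exact key i hi j hj
    · rw [SimpleGraph.adj_comm, SimpleGraph.edist_comm]; exact key j hj i hi
    · rw [← h2 i hi j hj hij, addEdges_adj]
      have := hE1 i j; have := hE1 j i; have := hd1 i; have := hd1 j; tauto

/-! ### Polynomials in connected counting terms -/

/-- The integer-valued function `F` of finite structures with a valuation is given by a combination
of connected counting terms and the integers `0` and `-1`. -/
def IsPoly (L : FirstOrder.Language.{0, 0}) [L.IsRelational] [Finite (Σ n, L.Relations n)]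
    (P : NumPredicates) (r m : ℕ) (V : Set ℕ)
    (F : ∀ (A : Type) [Finite A] [L.Structure A], (ℕ → A) → ℤ) : Prop :=
  ∃ t : Term L P,
    IsCombination (fun t => (t = .int 0 ∨ t = .int (-1)) ∨ IsConnectedCount r m V t) t ∧
    ∀ (A : Type) [Finite A] [L.Structure A] (β : ℕ → A), t.eval β = F A β

section

variable [L.IsRelational] [Finite (Σ n, L.Relations n)] {r m : ℕ} {V : Set ℕ}
  {F F' : ∀ (A : Type) [Finite A] [L.Structure A], (ℕ → A) → ℤ}

theorem IsPoly.congr (h : IsPoly L P r m V F)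
    (e : ∀ (A : Type) [Finite A] [L.Structure A] (β : ℕ → A), F' A β = F A β) :
    IsPoly L P r m V F' := by
  obtain ⟨t, h1, h2⟩ := h
  exact ⟨t, h1, fun A _ _ β => by rw [h2, e]⟩

theorem IsPoly.zero : IsPoly L P r m V (fun _ _ _ _ => 0) :=
  ⟨.int 0, .base (.inl (.inl rfl)), fun _ _ _ _ => by simp [Term.eval]⟩

theorem IsPoly.add (h : IsPoly L P r m V F) (h' : IsPoly L P r m V F') :
    IsPoly L P r m V (fun A _ _ β => F A β + F' A β) := by
  obtain ⟨t, h1, h2⟩ := h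
  obtain ⟨t', h1', h2'⟩ := h'
  exact ⟨.add t t', .add h1 h1', fun A _ _ β => by simp [Term.eval, h2, h2']⟩

theorem IsPoly.mul (h : IsPoly L P r m V F) (h' : IsPoly L P r m V F') :
    IsPoly L P r m V (fun A _ _ β => F A β * F' A β) := by
  obtain ⟨t, h1, h2⟩ := h
  obtain ⟨t', h1', h2'⟩ := h'
  exact ⟨.mul t t', .mul h1 h1', fun A _ _ β => by simp [Term.eval, h2, h2']⟩

theorem IsPoly.neg (h : IsPoly L P r m V F) : IsPoly L P r m V (fun A _ _ β => - F A β) := by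
  obtain ⟨t, h1, h2⟩ := h
  exact ⟨.mul (.int (-1)) t, .mul (.base (.inl (.inr rfl))) h1,
    fun A _ _ β => by simp [Term.eval, h2]⟩

theorem IsPoly.sub (h : IsPoly L P r m V F) (h' : IsPoly L P r m V F') :
    IsPoly L P r m V (fun A _ _ β => F A β - F' A β) :=
  (h.add h'.neg).congr fun _ _ _ _ => sub_eq_add_neg _ _

theorem IsPoly.sum {κ : Type} (s : Finset κ)
    {f : κ → ∀ (A : Type) [Finite A] [L.Structure A], (ℕ → A) → ℤ}
    (h : ∀ e ∈ s, IsPoly L P r m V (f e)) :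
    IsPoly L P r m V (fun A _ _ β => ∑ e ∈ s, f e A β) := by
  classical
  induction s using Finset.induction_on with
  | empty => simpa using IsPoly.zero
  | insert e s he ih =>
    refine ((h e (by simp)).add (ih fun e' he' => h e' (by simp [he']))).congr fun A _ _ β => ?_
    rw [Finset.sum_insert he]

end

open Classical in
/-- The ordered pairs of elements of `S` that are not joined by an edge of `G`. -/
noncomputable def nonEdges (S : Finset ℕ) (G : SimpleGraph ℕ) : Finset (ℕ × ℕ) :=
  (S ×ˢ S).filter fun p => ¬ G.Adj p.1 p.2

theorem mem_nonEdges {S : Finset ℕ} {G : SimpleGraph ℕ} {i j : ℕ} :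
    (i, j) ∈ nonEdges S G ↔ (i ∈ S ∧ j ∈ S) ∧ ¬ G.Adj i j := by
  simp [nonEdges]

/-- Diagonal pairs are non-edges, so dropping a vertex `i` always loses `(i, i)`. This lets one
measure handle both removal of vertices and addition of edges. -/
theorem nonEdges_ssubset_of_ssubset {S T : Finset ℕ} (h : S ⊂ T) (G : SimpleGraph ℕ) :
    nonEdges S G ⊂ nonEdges T G := by
  obtain ⟨i, hi, hi'⟩ := Finset.exists_of_ssubset h
  refine Finset.ssubset_iff_of_subset ?_ |>.2 ⟨(i, i), ?_, ?_⟩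
  · rintro ⟨a, b⟩ hab
    rw [mem_nonEdges] at hab ⊢
    exact ⟨⟨h.1 hab.1.1, h.1 hab.1.2⟩, hab.2⟩
  · simp [mem_nonEdges, hi]
  · simp [mem_nonEdges, hi']

theorem nonEdges_addEdges_ssubset {S₁ S₂ : Finset ℕ} (hd : Disjoint S₁ S₂) {G : SimpleGraph ℕ}
    (hG : ∀ i ∈ S₁, ∀ j ∈ S₂, ¬ G.Adj i j) {E : Finset (ℕ × ℕ)} (hE : E ⊆ S₁ ×ˢ S₂)
    (hne : E.Nonempty) : nonEdges (S₁ ∪ S₂) (addEdges G E) ⊂ nonEdges (S₁ ∪ S₂) G := by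
  obtain ⟨⟨i, j⟩, hij⟩ := hne
  have h := Finset.mem_product.1 (hE hij)
  have hne : i ≠ j := fun e => Finset.disjoint_left.1 hd h.1 (e ▸ h.2)
  refine Finset.ssubset_iff_of_subset ?_ |>.2 ⟨(i, j), ?_, ?_⟩
  · rintro ⟨a, b⟩ hab
    rw [mem_nonEdges, addEdges_adj] at *
    tauto
  · rw [mem_nonEdges]
    exact ⟨⟨Finset.mem_union_left _ h.1, Finset.mem_union_right _ h.2⟩, hG i h.1 j h.2⟩
  · rw [mem_nonEdges, addEdges_adj]
    tauto

/-- A nonempty finite set that does not induce a connected subgraph splits into two nonempty parts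
with no edges between them. -/
theorem exists_split_of_not_connected {n : ℕ} (e : Fin n → ℕ) (he : Function.Injective e)
    (hn : 0 < n) (G : SimpleGraph ℕ) (h : ¬ (G.comap e).Connected) :
    ∃ S₁ S₂ : Finset ℕ, S₁.Nonempty ∧ S₂.Nonempty ∧ Disjoint S₁ S₂ ∧
      Finset.univ.image e = S₁ ∪ S₂ ∧ ∀ i ∈ S₁, ∀ j ∈ S₂, ¬ G.Adj i j := by
  classical
  have : Nonempty (Fin n) := ⟨⟨0, hn⟩⟩
  rw [SimpleGraph.connected_iff, not_and_or] at h
  have h := h.resolve_right (not_not.2 this)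
  simp only [SimpleGraph.Preconnected, not_forall] at h
  obtain ⟨a, b, hab⟩ := h
  refine ⟨(Finset.univ.filter fun c => (G.comap e).Reachable a c).image e,
    (Finset.univ.filter fun c => ¬ (G.comap e).Reachable a c).image e,
    ⟨e a, ?_⟩, ⟨e b, ?_⟩, ?_, ?_, ?_⟩
  · exact Finset.mem_image_of_mem _ (by simp)
  · exact Finset.mem_image_of_mem _ (by simpa using hab)
  · rw [Finset.disjoint_image he]
    exact Finset.disjoint_filter_filter_not _ _ _
  · rw [← Finset.image_union, Finset.filter_union_filter_not_eq]
  · simp only [Finset.mem_image, Finset.mem_filter, Finset.mem_univ, true_and]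
    rintro _ ⟨i, hi, rfl⟩ _ ⟨j, hj, rfl⟩ hij
    exact hj (hi.trans (SimpleGraph.Adj.reachable (by simpa using hij)))

theorem image_append {n p : ℕ} (u : Fin n → ℕ) (z : Fin p → ℕ) :
    Finset.univ.image (Fin.append u z) = Finset.univ.image u ∪ Finset.univ.image z := by
  ext v
  simp only [Finset.mem_image, Finset.mem_univ, true_and, Finset.mem_union]
  constructor
  · rintro ⟨i, rfl⟩
    induction i using Fin.addCases with
    | left i => exact .inl ⟨i, by simp⟩
    | right i => exact .inr ⟨i, by simp⟩
  · rintro (⟨i, rfl⟩ | ⟨i, rfl⟩)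
    · exact ⟨Fin.castAdd p i, by simp⟩
    · exact ⟨Fin.natAdd n i, by simp⟩

/-- The number of ways to choose values for the variables in `Z` such that the local formula `ψ`
holds and the distance configuration is `G`, is a polynomial in connected counting terms. -/
theorem isPoly_cnt [L.IsRelational] [Finite (Σ n, L.Relations n)] {r m : ℕ} {V : Set ℕ}
    {Z : Finset ℕ} (hZ : Z.card ≤ m) {S : Finset ℕ} (hS : S.Nonempty)
    (hSV : ((S \ Z : Finset ℕ) : Set ℕ) ⊆ V) (G : SimpleGraph ℕ) {ψ : Formula L P}
    (hψ : LocalOn r S ψ) :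
    IsPoly L P r m V (fun _ _ _ β =>
      cnt (S ∩ Z) β (fun γ => ψ.Realize γ ∧ Config L (2 * r + 1) S G γ)) := by
  induction hN : (nonEdges S G).card using Nat.strong_induction_on generalizing S G ψ with
  | _ N ih =>
  subst hN
  let u : Fin (S \ Z).card → ℕ := (S \ Z).orderEmbOfFin rfl
  let z' : Fin (S ∩ Z).card ↪ ℕ := ((S ∩ Z).orderEmbOfFin rfl).toEmbedding
  have hu : Finset.univ.image u = S \ Z := by
    apply Finset.coe_injective; simp [u]
  have hz' : Finset.univ.image z' = S ∩ Z := by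
    apply Finset.coe_injective; simp [z']
  have himg : Finset.univ.image (Fin.append u z') = S := by
    rw [image_append, hu, hz', Finset.sdiff_union_inter]
  have hinj : Function.Injective (Fin.append u z') := by
    refine Fin.append_injective_iff.2 ⟨(S \ Z).orderEmbOfFin rfl |>.injective, z'.injective,
      fun i j h => ?_⟩
    have h1 : u i ∈ S \ Z := hu.subset (Finset.mem_image_of_mem _ (Finset.mem_univ _))
    have h2 : z' j ∈ S ∩ Z := hz'.subset (Finset.mem_image_of_mem _ (Finset.mem_univ _))
    rw [← h] at h2
    exact (Finset.mem_sdiff.1 h1).2 (Finset.mem_inter.1 h2).2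
  have hpos : 0 < (S \ Z).card + (S ∩ Z).card := by
    rw [Finset.card_sdiff_add_card_inter]; exact hS.card_pos
  by_cases hconn : (G.comap (Fin.append u z')).Connected
  · refine ⟨_, .base (.inr ⟨_, _, u, z', _, ψ, (Finset.card_le_card Finset.inter_subset_right).trans
      hZ, ?_, hinj, hconn, hψ.1, ?_, rfl⟩), fun A _ _ β => ?_⟩
    · rw [← hu] at hSV; simpa using hSV
    · rw [isLocal_iff_localOn hpos hψ.1 hinj, himg]; exact hψ
    · rw [eval_count, hz']
      refine cnt_congr _ _ fun γ => ?_
      rw [realize_and, realize_delta_comap _ hinj, himg]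
  obtain ⟨S₁, S₂, hS₁, hS₂, hd, hS₁₂, hG⟩ :=
    exists_split_of_not_connected _ hinj hpos G hconn
  rw [himg] at hS₁₂
  subst hS₁₂
  have hss₁ : S₁ ⊂ S₁ ∪ S₂ := by
    refine Finset.ssubset_iff_of_subset Finset.subset_union_left |>.2 ?_
    obtain ⟨i, hi⟩ := hS₂
    exact ⟨i, Finset.mem_union_right _ hi, Finset.disjoint_right.1 hd hi⟩
  have hss₂ : S₂ ⊂ S₁ ∪ S₂ := by
    refine Finset.ssubset_iff_of_subset Finset.subset_union_right |>.2 ?_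
    obtain ⟨i, hi⟩ := hS₁
    exact ⟨i, Finset.mem_union_left _ hi, Finset.disjoint_left.1 hd hi⟩
  have hsub : ∀ T ⊂ S₁ ∪ S₂, T.Nonempty → ∀ χ : Formula L P, LocalOn r T χ →
      IsPoly L P r m V (fun A _ _ β =>
        cnt (T ∩ Z) β (fun γ => χ.Realize γ ∧ Config L (2 * r + 1) T G γ)) := by
    intro T hT hne χ hχ
    refine ih _ (Finset.card_lt_card (nonEdges_ssubset_of_ssubset hT G)) hne
      (subset_trans ?_ hSV) G hχ rfl
    exact_mod_cast Finset.sdiff_subset_sdiff hT.1 subset_rfl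
  have hG0 : addEdges G ∅ = G := by ext i j; simp [addEdges_adj]
  -- Product of the two separate counts, minus the assignments in which some cross pair is close,
  -- classified by the nonempty set `E` of such pairs.
  have hpair : ∀ α χ : Formula L P, LocalOn r S₁ α → LocalOn r S₂ χ →
      IsPoly L P r m V (fun A _ _ β => cnt ((S₁ ∪ S₂) ∩ Z) β (fun γ =>
        (α.Realize γ ∧ χ.Realize γ) ∧ Config L (2 * r + 1) (S₁ ∪ S₂) G γ)) := by
    intro α χ hα hχ
    have hsum := IsPoly.sum (P := P) (r := r) (m := m) (V := V) ((S₁ ×ˢ S₂).powerset.erase ∅)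
      (f := fun E A _ _ β => cnt ((S₁ ∪ S₂) ∩ Z) β (fun γ => (α.and χ).Realize γ ∧
        Config L (2 * r + 1) (S₁ ∪ S₂) (addEdges G E) γ)) (by
        intro E hE
        rw [Finset.mem_erase, Finset.mem_powerset] at hE
        exact ih _ (Finset.card_lt_card (nonEdges_addEdges_ssubset hd hG hE.2
          (Finset.nonempty_iff_ne_empty.2 hE.1))) hS hSV _
          ((hα.mono hS₁ Finset.subset_union_left).and (hχ.mono hS₂ Finset.subset_union_right)) rfl)
    refine (((hsub S₁ hss₁ hS₁ α hα).mul (hsub S₂ hss₂ hS₂ χ hχ)).sub hsum).congr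
      fun A _ _ β => ?_
    have hTd : Disjoint (S₁ ∩ Z) (S₂ ∩ Z) :=
      hd.mono Finset.inter_subset_left Finset.inter_subset_left
    rw [eq_sub_iff_add_eq, ← cnt_mul _ _ hTd, ← Finset.union_inter_distrib_right,
      cnt_eq_sum_fiber _ _ (fun γ => (α.Realize γ ∧ Config L (2 * r + 1) S₁ G γ) ∧ _)
        (closePairs L (2 * r + 1) S₁ S₂) (S₁ ×ˢ S₂).powerset,
      ← Finset.add_sum_erase (S₁ ×ˢ S₂).powerset _ (Finset.empty_mem_powerset _)]
    · congr 1
      · refine cnt_congr _ _ fun γ => ?_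
        have := config_addEdges_iff (L := L) (R := 2 * r + 1) hd hG (Finset.empty_subset _) γ
        rw [hG0] at this
        rw [this]; tauto
      · refine Finset.sum_congr rfl fun E hE => cnt_congr _ _ fun γ => ?_
        rw [Finset.mem_erase, Finset.mem_powerset] at hE
        rw [config_addEdges_iff hd hG hE.2, realize_and]; tauto
    · exact fun γ => Finset.mem_powerset.2 (Finset.filter_subset _ _)
    · rintro γ γ' h ⟨h1, h2⟩
      have h' : ∀ v ∈ S₁, γ v = γ' v := fun v hv => h v fun hv' =>
        Finset.disjoint_left.1 hd hv (Finset.mem_inter.1 hv').1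
      exact ⟨(realize_congr hα.1 fun v hv => h' v (hα.2.1 hv)).1 h1, h2.congr h'⟩
    · rintro γ γ' h ⟨h1, h2⟩
      have h' : ∀ v ∈ S₂, γ v = γ' v := fun v hv => h v fun hv' =>
        Finset.disjoint_right.1 hd hv (Finset.mem_inter.1 hv').1
      exact ⟨(realize_congr hχ.1 fun v hv => h' v (hχ.2.1 hv)).1 h1, h2.congr h'⟩
  -- The disjuncts need not exclude each other, hence inclusion–exclusion. The prefix `α`, `χ` is
  -- generalized because the overlap of `p` with the remaining list is a count of the same shape,
  -- with `p` absorbed into the prefix.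
  have hlist : ∀ l : List (Formula L P × Formula L P),
      (∀ p ∈ l, LocalOn r S₁ p.1 ∧ LocalOn r S₂ p.2) → ∀ α χ : Formula L P,
      LocalOn r S₁ α → LocalOn r S₂ χ →
      IsPoly L P r m V (fun A _ _ β => cnt ((S₁ ∪ S₂) ∩ Z) β (fun γ =>
        ((α.Realize γ ∧ χ.Realize γ) ∧ ∃ p ∈ l, p.1.Realize γ ∧ p.2.Realize γ) ∧
          Config L (2 * r + 1) (S₁ ∪ S₂) G γ)) := by
    intro l
    induction l with
    | nil =>
      intro _ α χ _ _
      refine IsPoly.zero.congr fun A _ _ β => ?_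
      rw [← cnt_false ((S₁ ∪ S₂) ∩ Z) β]
      exact cnt_congr _ _ fun γ => by simp
    | cons p l ihl =>
      intro hl α χ hα hχ
      obtain ⟨hp1, hp2⟩ := hl p (by simp)
      have hl' : ∀ p ∈ l, LocalOn r S₁ p.1 ∧ LocalOn r S₂ p.2 := fun q hq => hl q (by simp [hq])
      refine (((hpair _ _ (hα.and hp1) (hχ.and hp2)).add (ihl hl' α χ hα hχ)).sub
        (ihl hl' _ _ (hα.and hp1) (hχ.and hp2))).congr fun A _ _ β => ?_
      rw [cnt_congr _ _ (Q' := fun γ =>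
          (((α.and p.1).Realize γ ∧ (χ.and p.2).Realize γ) ∧
            Config L (2 * r + 1) (S₁ ∪ S₂) G γ) ∨
          (((α.Realize γ ∧ χ.Realize γ) ∧ ∃ p ∈ l, p.1.Realize γ ∧ p.2.Realize γ) ∧
            Config L (2 * r + 1) (S₁ ∪ S₂) G γ)), cnt_or]
      · congr 1
        refine cnt_congr _ _ fun γ => ?_
        simp only [realize_and]; tauto
      · intro γ
        simp only [realize_and, List.mem_cons, or_and_right, exists_or, exists_eq_left]
        tauto
  obtain ⟨l, hl, hsplit⟩ := hψ.exists_split hS₁ hS₂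
  refine (hlist l hl _ _ (localOn_verum r hS₁) (localOn_verum r hS₂)).congr fun A _ _ β => ?_
  refine cnt_congr _ _ fun γ => and_congr_left fun hc => ?_
  rw [hsplit A γ]
  · simp only [realize_verum, true_and]
  · intro i hi j hj
    rw [← hc i (Finset.mem_union_left _ hi) j (Finset.mem_union_right _ hj)
      fun e => Finset.disjoint_left.1 hd hi (e ▸ hj)]
    exact hG i hi j hj

/-! ### Sizes of balls -/

theorem exists_adj_of_edist_eq_succ {V : Type} (G : SimpleGraph V) {a b : V} {i : ℕ}
    (h : G.edist a b = (i + 1 : ℕ)) : ∃ c, G.edist a c = i ∧ G.Adj c b := by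
  rcases (edist_succ G i a b).1 h.le with h' | ⟨c, hc, hcb⟩
  · rw [h] at h'
    exact absurd (Nat.cast_le.1 h') (by omega)
  · refine ⟨c, le_antisymm hc ?_, hcb⟩
    by_contra hlt
    rcases i with _ | i
    · exact hlt (by simp)
    · have : G.edist a c ≤ i := Order.le_of_lt_add_one (by simpa using hlt)
      have := (edist_succ G i a b).2 (.inr ⟨c, this, hcb⟩)
      rw [h] at this
      exact absurd (Nat.cast_le.1 this) (by omega)

/-- Beyond the first sphere, every vertex spends one of its at most `d` edges on a predecessor,
leaving `d - 1` for the next sphere. -/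
theorem ncard_sphere_le {V : Type} [Finite V] (G : SimpleGraph V) {d : ℕ}
    (hd : ∀ v, (G.neighborSet v).ncard ≤ d) (a : V) (i : ℕ) :
    {b | G.edist a b = (i + 1 : ℕ)}.ncard ≤ d * (d - 1) ^ i := by
  induction i with
  | zero =>
    refine le_trans (Set.ncard_le_ncard ?_) ((hd a).trans (by simp))
    intro b hb
    exact SimpleGraph.edist_eq_one_iff_adj.1 (by simpa using hb)
  | succ i ih =>
    classical
    have hfin : {b | G.edist a b = (i + 1 : ℕ)}.Finite := Set.toFinite _
    have hsub : {b | G.edist a b = (i + 1 + 1 : ℕ)} ⊆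
        ⋃ c ∈ hfin.toFinset, (G.neighborSet c ∩ {b | G.edist a b = (i + 1 + 1 : ℕ)}) := by
      intro b hb
      obtain ⟨c, hc, hcb⟩ := exists_adj_of_edist_eq_succ G hb
      simp only [Set.mem_iUnion]
      exact ⟨c, by simpa using hc, hcb, hb⟩
    have hone : ∀ c ∈ hfin.toFinset,
        (G.neighborSet c ∩ {b | G.edist a b = (i + 1 + 1 : ℕ)}).ncard ≤ d - 1 := by
      intro c hc
      have hc : G.edist a c = (i + 1 : ℕ) := by simpa using hc
      obtain ⟨c', hc', hadj⟩ := exists_adj_of_edist_eq_succ G hc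
      refine Nat.le_sub_one_of_lt (lt_of_lt_of_le (Set.ncard_lt_ncard ?_) (hd c))
      refine ⟨Set.inter_subset_left, fun h => ?_⟩
      have := (h (show c' ∈ G.neighborSet c from hadj.symm)).2
      rw [Set.mem_ofPred_eq, hc'] at this
      exact absurd (Nat.cast_inj.1 this) (by omega)
    calc {b | G.edist a b = (i + 1 + 1 : ℕ)}.ncard
        ≤ _ := Set.ncard_le_ncard hsub
      _ ≤ ∑ c ∈ hfin.toFinset, (G.neighborSet c ∩ {b | G.edist a b = (i + 1 + 1 : ℕ)}).ncard :=
        Finset.set_ncard_biUnion_le _ _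
      _ ≤ hfin.toFinset.card * (d - 1) := Finset.sum_le_card_nsmul _ _ _ hone
      _ ≤ d * (d - 1) ^ i * (d - 1) := by
        rw [← Set.ncard_eq_toFinset_card _ hfin]; exact Nat.mul_le_mul_right _ ih
      _ = d * (d - 1) ^ (i + 1) := by ring

theorem ncard_closedBall_le_nu {V : Type} [Finite V] (G : SimpleGraph V) {d : ℕ}
    (hd : ∀ v, (G.neighborSet v).ncard ≤ d) (a : V) (R : ℕ) :
    {b | G.edist a b ≤ R}.ncard ≤ nu d R := by
  induction R with
  | zero => simp [nu]
  | succ R ih =>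
    have hsub : {b | G.edist a b ≤ (R + 1 : ℕ)} ⊆
        {b | G.edist a b ≤ R} ∪ {b | G.edist a b = (R + 1 : ℕ)} := by
      intro b hb
      by_cases h : G.edist a b ≤ R
      · exact .inl h
      · exact .inr (le_antisymm hb (by push_cast; exact Order.add_one_le_of_lt (not_le.1 h)))
    refine (Set.ncard_le_ncard hsub).trans ((Set.ncard_union_le _ _).trans
      ((Nat.add_le_add ih (ncard_sphere_le G hd a R)).trans_eq ?_))
    simp only [nu, Finset.sum_range_succ]
    ring

theorem ncard_neighborSet_le_degree {A : Type} [Finite A] [L.Structure A] (a : A) :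
    ((gaifman L A).neighborSet a).ncard ≤ degree L A :=
  le_ciSup (f := fun a => ((gaifman L A).neighborSet a).ncard) (Set.finite_range _).bddAbove a

theorem ncard_ball_le {A : Type} [Finite A] [L.Structure A] {l : ℕ} (w : Fin l → A) (R : ℕ) :
    (ball L R w).ncard ≤ l * nu (degree L A) R := by
  have e : ball L R w = ⋃ j, {b | (gaifman L A).edist (w j) b ≤ R} := by ext b; simp [ball]
  rw [e]
  refine (Set.ncard_iUnion_le_of_fintype _).trans ?_
  refine (Finset.sum_le_card_nsmul _ _ _ fun j _ =>
    ncard_closedBall_le_nu _ ncard_neighborSet_le_degree (w j) R).trans_eq (by simp)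

/-! ### Distances in connected configurations -/

/-- On a shortest walk to the nearest point of `X`, all vertices before the last are distinct and
outside `X`. -/
theorem exists_dist_le_card_compl {n : ℕ} {H : SimpleGraph (Fin n)} (hH : H.Connected)
    {X : Finset (Fin n)} (hX : X.Nonempty) (j : Fin n) :
    ∃ i ∈ X, H.dist j i ≤ (Xᶜ).card := by
  obtain ⟨i, hi, hmin⟩ := X.exists_min_image (H.dist j) hX
  obtain ⟨p, hp⟩ := hH.exists_walk_length_eq_dist j i
  refine ⟨i, hi, ?_⟩
  rw [← Finset.card_range (H.dist j i)]
  refine Finset.card_le_card_of_injOn p.getVert (fun t ht => ?_) fun t ht t' ht' h => ?_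
  · have ht : t < H.dist j i := by simpa using ht
    simp only [Finset.coe_compl, Set.mem_compl_iff, Finset.mem_coe]
    intro h
    have h1 := hmin _ h
    have h2 := SimpleGraph.dist_le (p.take t)
    rw [SimpleGraph.Walk.take_length] at h2
    omega
  · have hp' := (SimpleGraph.Walk.isPath_of_length_eq_dist p hp).getVert_injOn
    have ht : t < H.dist j i := by simpa using ht
    have ht' : t' < H.dist j i := by simpa using ht'
    exact hp' (show t ≤ _ by omega) (show t' ≤ _ by omega) h

theorem edist_le_mul_length {V W : Type} {H : SimpleGraph V} {G : SimpleGraph W} {f : V → W}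
    {R : ℕ} (hf : ∀ i j, H.Adj i j → G.edist (f i) (f j) ≤ R) {i j : V} (p : H.Walk i j) :
    G.edist (f i) (f j) ≤ (R * p.length : ℕ) := by
  induction p with
  | nil => simp
  | cons h p ih =>
    refine SimpleGraph.edist_triangle.trans ((add_le_add (hf _ _ h) ih).trans_eq ?_)
    rw [SimpleGraph.Walk.length_cons]
    push_cast; ring

/-- If the distance configuration of `e` is a connected graph, then all values of `e` are close to
the values at each nonempty set `X` of positions. -/
theorem exists_edist_le_of_realize_delta [Finite (Σ n, L.Relations n)] {A : Type} [L.Structure A]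
    {n R K : ℕ} {H : SimpleGraph (Fin n)} (hH : H.Connected) {e : Fin n → ℕ} {γ : ℕ → A}
    (h : (Formula.delta H R e : Formula L P).Realize γ) {X : Finset (Fin n)} (hX : X.Nonempty)
    (hK : (Xᶜ).card ≤ K) (j : Fin n) :
    ∃ i ∈ X, (gaifman L A).edist (γ (e i)) (γ (e j)) ≤ (R * K : ℕ) := by
  rw [realize_delta] at h
  obtain ⟨i, hi, hij⟩ := exists_dist_le_card_compl hH hX j
  obtain ⟨p, hp⟩ := hH.exists_walk_length_eq_dist j i
  refine ⟨i, hi, ?_⟩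
  rw [SimpleGraph.edist_comm]
  refine (edist_le_mul_length (f := fun i => γ (e i)) (fun a b hab => (h a b hab.ne).1 hab) p).trans
    ?_
  exact Nat.cast_le.2 (Nat.mul_le_mul_left _ (hp.trans_le (hij.trans hK)))

/-! ### Connected counting terms -/

theorem free_count_subset [Finite (Σ n, L.Relations n)] {n p : ℕ} {u : Fin n → ℕ}
    {z : Fin p ↪ ℕ} {H : SimpleGraph (Fin (n + p))}
    {R : ℕ} {ψ : Formula L P} (hψ : (ψ.free : Set ℕ) ⊆ Set.range (Fin.append u z)) :
    (ψ.and (.delta H R (Fin.append u z))).free ⊆ Finset.univ.image u ∪ Finset.univ.image z := by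
  rw [Formula.free_and, ← image_append]
  refine Finset.union_subset ?_ (Formula.free_delta_subset _ _ _)
  rw [← Finset.coe_subset]
  simpa using hψ

theorem IsConnectedCount.isFOC1 [L.IsRelational] [Finite (Σ n, L.Relations n)]
    {r m : ℕ} {V : Set ℕ} {t : Term L P}
    (h : IsConnectedCount r m V t) : t.IsFOC1 := by
  obtain ⟨n, p, u, z, H, ψ, -, -, -, -, hψ, -, rfl⟩ := h
  exact (hψ.and (Formula.isFO_delta _ _ _)).isFOC1

theorem IsConnectedCount.free_subset [L.IsRelational] [Finite (Σ n, L.Relations n)]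
    {r m : ℕ} {V : Set ℕ} {t : Term L P}
    (h : IsConnectedCount r m V t) : (t.free : Set ℕ) ⊆ V := by
  obtain ⟨n, p, u, z, H, ψ, -, hu, -, -, -, hloc, rfl⟩ := h
  intro v hv
  simp only [Term.free, Finset.coe_sdiff, Set.mem_sdiff, Finset.mem_coe] at hv
  rcases Finset.mem_union.1 (free_count_subset hloc.1 hv.1) with h | h
  · exact hu (by simpa using h)
  · exact absurd h hv.2

theorem eval_count_congr {A : Type} [L.Structure A] {n p : ℕ} {u : Fin n → ℕ} {z : Fin p ↪ ℕ}
    (hinj : Function.Injective (Fin.append u z)) {φ : Formula L P} (hφ : φ.IsFO)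
    (hf : φ.free ⊆ Finset.univ.image u ∪ Finset.univ.image z) {β β' : ℕ → A}
    (h : ∀ i, β (u i) = β' (u i)) : (Term.count z φ).eval β = (Term.count z φ).eval β' := by
  have key : ∀ a : Fin p → A, φ.Realize (Function.extend z a β) ↔
      φ.Realize (Function.extend z a β') := fun a => realize_congr hφ fun v hv => by
    rcases Finset.mem_union.1 (hf hv) with h' | h'
    · obtain ⟨i, -, rfl⟩ := Finset.mem_image.1 h'
      have : ¬ ∃ j, z j = u i := fun ⟨j, hj⟩ =>
        (Fin.append_injective_iff.1 hinj).2.2 i j hj.symm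
      rw [Function.extend_apply' _ _ _ this, Function.extend_apply' _ _ _ this, h]
    · obtain ⟨j, -, rfl⟩ := Finset.mem_image.1 h'
      rw [z.injective.extend_apply, z.injective.extend_apply]
  simp only [Term.eval, key]

/-- The value of a connected counting term whose free variables take values in the tuple `w`. -/
theorem eval_connectedCount_le [Finite (Σ n, L.Relations n)] {A : Type} [Finite A]
    [L.Structure A] {n p l R m : ℕ} (hn : 0 < n) (hp : p ≤ m) {u : Fin n → ℕ} {z : Fin p ↪ ℕ} (hinj : Function.Injective (Fin.append u z))
    {H : SimpleGraph (Fin (n + p))} (hH : H.Connected) (ψ : Formula L P) (w : Fin l → A)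
    {β : ℕ → A} (hβ : ∀ i, ∃ j, β (u i) = w j) :
    (Term.count z (ψ.and (.delta H R (Fin.append u z)))).eval β ≤
      (((l * nu (degree L A) (R * m)) ^ m : ℕ) : ℤ) := by
  -- Needed at the end: raising the exponent from `p` to `m` requires a positive base.
  have hl : 0 < l := by
    obtain ⟨j, -⟩ := hβ ⟨0, hn⟩
    exact j.pos
  have hmem : ∀ a : Fin p → A,
      (ψ.and (.delta H R (Fin.append u z))).Realize (Function.extend z a β) →
      ∀ i, a i ∈ ball L (R * m) w := by
    intro a ha i
    rw [realize_and] at ha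
    -- Taking `X` to be all positions of `u` leaves only the `p ≤ m` counted positions outside,
    -- whence the radius `R * m`.
    have hX : (Finset.univ.image (Fin.castAdd p : Fin n → Fin (n + p))).Nonempty :=
      ⟨_, Finset.mem_image_of_mem _ (Finset.mem_univ ⟨0, hn⟩)⟩
    obtain ⟨j, hj, hd⟩ := exists_edist_le_of_realize_delta hH ha.2 hX (K := m) (by
      rw [Finset.card_compl, Finset.card_image_of_injective _ (Fin.castAdd_injective n p)]
      simpa using hp) (Fin.natAdd n i)
    obtain ⟨j, -, rfl⟩ := Finset.mem_image.1 hj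
    have : ¬ ∃ i, z i = u j := fun ⟨i, hi⟩ =>
      (Fin.append_injective_iff.1 hinj).2.2 j i hi.symm
    rw [Fin.append_left, Fin.append_right, z.injective.extend_apply,
      Function.extend_apply' _ _ _ this] at hd
    obtain ⟨k, hk⟩ := hβ j
    exact ⟨k, hk ▸ hd⟩
  simp only [Term.eval]
  refine Nat.cast_le.2 ?_
  calc _ ≤ Nat.card (Fin p → ball L (R * m) w) :=
        Nat.card_le_card_of_injective (fun a i => ⟨a.1 i, hmem a.1 a.2 i⟩) fun a b h =>
          Subtype.ext (funext fun i => congrArg Subtype.val (congrFun h i))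
    _ = (ball L (R * m) w).ncard ^ p := by
        rw [Nat.card_fun, Nat.card_fin, Nat.card_coe_set_eq]
    _ ≤ (l * nu (degree L A) (R * m)) ^ p := Nat.pow_le_pow_left (ncard_ball_le w _) _
    _ ≤ _ := Nat.pow_le_pow_right (Nat.mul_pos hl (by simp [nu])) hp

/-- The base terms that may occur in the final combination. -/
def IsBase [L.IsRelational] [Finite (Σ n, L.Relations n)]
    (r m N : ℕ) (V : Set ℕ) (t : Term L P) : Prop :=
  (∃ i : ℤ, -1 ≤ i ∧ i ≤ (N : ℤ) ∧ t = .int i) ∨ IsConnectedCount r m V t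

theorem IsCombination.isFOC1_and_free_subset [L.IsRelational] [Finite (Σ n, L.Relations n)]
    {r m N : ℕ} {V : Set ℕ} {t : Term L P}
    (h : IsCombination (IsBase r m N V) t) : t.IsFOC1 ∧ (t.free : Set ℕ) ⊆ V := by
  induction h with
  | base h =>
    rcases h with ⟨i, -, -, rfl⟩ | h
    · simp [Term.IsFOC1, Term.free]
    · exact ⟨h.isFOC1, h.free_subset⟩
  | add _ _ ih₁ ih₂ => simp [Term.IsFOC1, Term.free, ih₁, ih₂]
  | mul _ _ ih₁ ih₂ => simp [Term.IsFOC1, Term.free, ih₁, ih₂]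

/-- The values of `t` at the tuples `(vᵢ, w)` are the values of `t'` at the tuples `(vᵢ, w')`, for
each `w'` that agrees with `w` on `N`. -/
def SameValues {A : Type} [L.Structure A] {s k l : ℕ} (N : Set A) (x : Fin k → ℕ) (y : Fin l → ℕ)
    (v : Fin s → Fin k → A) (w : Fin l → A) (t t' : Term L P) : Prop :=
  ∀ w' : Fin l → A, AgreeOn N w w' → ∀ (i : Fin s) (β β' : ℕ → A),
    (∀ j, β (Fin.append x y j) = Fin.append (v i) w j) →
    (∀ j, β' (Fin.append x y j) = Fin.append (v i) w' j) → t.eval β = t'.eval β'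

/-- Three cases: the term is kept, replaced by `0`, or replaced by its value at `w`. The replacement
is chosen before `w'` and `i`, so it serves all of them at once. -/
theorem IsConnectedCount.exists_sameValues [L.IsRelational] [Finite (Σ n, L.Relations n)]
    {r k l m s : ℕ} {x : Fin k → ℕ} {y : Fin l → ℕ}
    (hxy : Function.Injective (Fin.append x y)) {A : Type} [Finite A] [L.Structure A]
    (v : Fin s → Fin k → A) (w : Fin l → A) {t : Term L P}
    (ht : IsConnectedCount r m (Set.range (Fin.append x y)) t) :
    ∃ t' : Term L P, t'.size ≤ t.size ∧
      IsBase r m ((l * nu (degree L A) ((2 * r + 1) * m)) ^ m) (Set.range (Fin.append x y)) t' ∧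
      SameValues (ball L ((2 * r + 1) * (l + m)) (fun ij : Fin s × Fin k => v ij.1 ij.2))
        x y v w t t' := by
  have ht' := ht
  obtain ⟨n, p, u, z, H, ψ, hp, hu, hinj, hH, hψ, hloc, rfl⟩ := ht
  have hcongr : ∀ β β' : ℕ → A, (∀ i, β (u i) = β' (u i)) → _ := fun β β' h =>
    eval_count_congr hinj (hψ.and (Formula.isFO_delta H (2 * r + 1) _))
      (free_count_subset hloc.1) h
  have hu' : ∀ i, (∃ j, u i = x j) ∨ ∃ j, u i = y j := by
    intro i
    obtain ⟨j, hj⟩ := hu ⟨i, rfl⟩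
    induction j using Fin.addCases with
    | left j => exact .inl ⟨j, by simpa using hj.symm⟩
    | right j => exact .inr ⟨j, by simpa using hj.symm⟩
  set N := ball L ((2 * r + 1) * (l + m)) (fun ij : Fin s × Fin k => v ij.1 ij.2) with hN
  by_cases hgood : ∀ i j, u i = y j → w j ∈ N
  · refine ⟨_, le_rfl, .inr ht', fun w' hw' i β β' hβ hβ' => hcongr β β' fun a => ?_⟩
    rcases hu' a with ⟨j, hj⟩ | ⟨j, hj⟩
    · have h1 := hβ (Fin.castAdd l j)
      have h2 := hβ' (Fin.castAdd l j)
      simp only [Fin.append_left] at h1 h2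
      rw [hj, h1, h2]
    · have h1 := hβ (Fin.natAdd k j)
      have h2 := hβ' (Fin.natAdd k j)
      simp only [Fin.append_right] at h1 h2
      rw [hj, h1, h2, hw' j (hgood a j hj)]
  push Not at hgood
  obtain ⟨a, b, hab, hbN⟩ := hgood
  have hsize : ∀ i : ℤ, (Term.int i : Term L P).size ≤
      (Term.count z (ψ.and (.delta H (2 * r + 1) (Fin.append u z)))).size := fun i => by
    simp only [Term.size]; omega
  -- From here on `w b` lies outside `N`. If an `x`-variable also occurs, a satisfying assignment
  -- would put `w b` within `(2r + 1)(l + m)` of some entry of `v i`, so there is none.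
  by_cases hx : ∃ i j, u i = x j
  · obtain ⟨c, e, hce⟩ := hx
    refine ⟨.int 0, hsize 0, .inl ⟨0, by simp, by positivity, rfl⟩,
      fun w' hw' i β β' hβ hβ' => ?_⟩
    classical
    have hext : ∀ (f : Fin p → A) (j : Fin n), Function.extend z f β (u j) = β (u j) := fun f j =>
      Function.extend_apply' _ _ _ fun ⟨q, hq⟩ =>
        (Fin.append_injective_iff.1 hinj).2.2 j q hq.symm
    have : IsEmpty {f : Fin p → A // (ψ.and (.delta H (2 * r + 1) (Fin.append u z))).Realize
        (Function.extend z f β)} := by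
      refine ⟨fun ⟨f, hf⟩ => hbN ?_⟩
      rw [realize_and] at hf
      -- The restriction to positions of `u` matters: a counted variable may carry the name of an
      -- `x`-variable not in `u`, and its value then does not come from `v i`. Outside `X` there
      -- remain at most `l` positions named by `y` and `p ≤ m` counted ones.
      let X : Finset (Fin (n + p)) := Finset.univ.filter fun q =>
        q ∈ Set.range (Fin.castAdd p) ∧ Fin.append u z q ∈ Set.range x
      have hXc : (Xᶜ).card ≤ l + m := by
        calc (Xᶜ).card ≤ (Finset.univ.image y ∪ Finset.univ.image z).card := by
              refine Finset.card_le_card_of_injOn (Fin.append u z) (fun q hq => ?_) hinj.injOn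
              simp only [X, Finset.coe_compl, Finset.coe_filter, Set.mem_compl_iff,
                Set.mem_ofPred_eq, Finset.mem_univ, true_and, not_and] at hq
              induction q using Fin.addCases with
              | left q =>
                have hq := hq ⟨q, rfl⟩
                rw [Fin.append_left] at hq ⊢
                rcases hu' q with ⟨j, hj⟩ | ⟨j, hj⟩
                · exact absurd ⟨j, hj.symm⟩ hq
                · simp [hj]
              | right q => simp
          _ ≤ l + m := (Finset.card_union_le _ _).trans (Nat.add_le_add
              (Finset.card_image_le.trans (by simp)) (Finset.card_image_le.trans (by simpa using hp)))
      obtain ⟨q, hq, hd⟩ := exists_edist_le_of_realize_delta hH hf.2 (X := X)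
        ⟨Fin.castAdd p c, by simp [X, hce]⟩ hXc (Fin.castAdd p a)
      simp only [X, Finset.mem_filter, Finset.mem_univ, true_and] at hq
      obtain ⟨⟨q, rfl⟩, g, hg⟩ := hq
      rw [Fin.append_left] at hg
      have h1 := hβ (Fin.castAdd l g)
      have h2 := hβ (Fin.natAdd k b)
      simp only [Fin.append_left, Fin.append_right] at h1 h2
      rw [Fin.append_left, Fin.append_left, hext, hext, ← hg, hab, h1, h2] at hd
      exact ⟨(i, g), hd⟩
    simp only [Term.eval, Nat.card_of_isEmpty, Nat.cast_zero]
  · have hy : ∀ i, ∃ j, u i = y j := fun i => (hu' i).resolve_left fun ⟨j, hj⟩ => hx ⟨i, j, hj⟩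
    have hyinj : Function.Injective y := (Fin.append_injective_iff.1 hxy).2.1
    -- The default `w b` only supplies some element of `A`; the term reads `β₀` on `y`-variables
    -- alone.
    let β₀ : ℕ → A := Function.extend y w fun _ => w b
    have hβ₀ : ∀ j, β₀ (y j) = w j := fun j => hyinj.extend_apply _ _ _
    refine ⟨.int ((Term.count z (ψ.and (.delta H (2 * r + 1) (Fin.append u z)))).eval β₀),
      hsize _, .inl ⟨_, ?_, ?_, rfl⟩, fun w' hw' i β β' hβ hβ' => ?_⟩
    · simp only [Term.eval]; omega
    · exact eval_connectedCount_le a.pos hp hinj hH ψ w fun i => by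
        obtain ⟨j, hj⟩ := hy i
        exact ⟨j, by rw [hj, hβ₀]⟩
    · rw [hcongr β β₀ fun c => ?_]
      · simp only [Term.eval]
      · obtain ⟨j, hj⟩ := hy c
        have h1 := hβ (Fin.natAdd k j)
        simp only [Fin.append_right] at h1
        rw [hj, h1, hβ₀]

theorem IsCombination.exists_sameValues [L.IsRelational] [Finite (Σ n, L.Relations n)]
    {r k l m s : ℕ} {x : Fin k → ℕ} {y : Fin l → ℕ}
    (hxy : Function.Injective (Fin.append x y)) {A : Type} [Finite A] [L.Structure A]
    (v : Fin s → Fin k → A) (w : Fin l → A) {t : Term L P}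
    (ht : IsCombination (fun t => (t = .int 0 ∨ t = .int (-1)) ∨
      IsConnectedCount r m (Set.range (Fin.append x y)) t) t) :
    ∃ t' : Term L P, t'.size ≤ t.size ∧
      IsCombination (IsBase r m ((l * nu (degree L A) ((2 * r + 1) * m)) ^ m)
        (Set.range (Fin.append x y))) t' ∧
      SameValues (ball L ((2 * r + 1) * (l + m)) (fun ij : Fin s × Fin k => v ij.1 ij.2))
        x y v w t t' := by
  induction ht with
  | base h =>
    rcases h with (rfl | rfl) | h
    · exact ⟨.int 0, le_rfl, .base (.inl ⟨0, by simp, by positivity, rfl⟩),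
        fun _ _ _ _ _ _ _ => by simp only [Term.eval]⟩
    -- The constant `-1`, introduced by subtraction in the polynomial, accounts for the lower bound
    -- on the integers.
    · exact ⟨.int (-1), le_rfl,
        .base (.inl ⟨-1, le_rfl, le_trans (by simp) (Int.natCast_nonneg _), rfl⟩),
        fun _ _ _ _ _ _ _ => by simp only [Term.eval]⟩
    · obtain ⟨t', h1, h2, h3⟩ := h.exists_sameValues hxy v w
      exact ⟨t', h1, .base h2, h3⟩
  | add _ _ ih₁ ih₂ =>
    obtain ⟨t₁, a1, a2, a3⟩ := ih₁
    obtain ⟨t₂, b1, b2, b3⟩ := ih₂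
    refine ⟨.add t₁ t₂, by simp only [Term.size]; omega, .add a2 b2,
      fun w' hw' i β β' hβ hβ' => ?_⟩
    simp only [Term.eval, a3 w' hw' i β β' hβ hβ', b3 w' hw' i β β' hβ hβ']
  | mul _ _ ih₁ ih₂ =>
    obtain ⟨t₁, a1, a2, a3⟩ := ih₁
    obtain ⟨t₂, b1, b2, b3⟩ := ih₂
    refine ⟨.mul t₁ t₂, by simp only [Term.size]; omega, .mul a2 b2,
      fun w' hw' i β β' hβ hβ' => ?_⟩
    simp only [Term.eval, a3 w' hw' i β β' hβ hβ', b3 w' hw' i β β' hβ hβ']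

end FOC1

theorem lemma4p2 (L : FirstOrder.Language.{0, 0}) [L.IsRelational] [Finite (Σ n, L.Relations n)]
    (P : FOC1.NumPredicates) (r k l m : ℕ) (hklm : 1 ≤ k + l + m)
    (x : Fin k → ℕ) (y : Fin l → ℕ) (z : Fin m ↪ ℕ)
    (hxyz : Function.Injective (Fin.append (Fin.append x y) z))
    (φ : FOC1.Formula L P) (hφ : φ.IsFO)
    (hloc : FOC1.IsLocal r φ (Fin.append (Fin.append x y) z))
    (G : SimpleGraph (Fin (k + l + m)))
    (uG : FOC1.Term L P)
    (huG : uG = .count z (.and φ (.delta G (2 * r + 1) (Fin.append (Fin.append x y) z)))) :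
    ∃ q : ℕ, ∀ (A : Type) [Finite A] [L.Structure A] (s : ℕ), 1 ≤ s →
      ∀ (v : Fin s → Fin k → A) (w : Fin l → A),
      ∃ u' : FOC1.Term L P,
        u'.InFOC1 (k + l) q ∧
        (u'.free : Set ℕ) ⊆ Set.range (Fin.append x y) ∧
        (∀ w' : Fin l → A,
          FOC1.AgreeOn
            (FOC1.ball L ((2 * r + 1) * (l + m)) (fun ij : Fin s × Fin k => v ij.1 ij.2)) w w' →
          ∀ (i : Fin s) (β β' : ℕ → A),
            (∀ j, β (Fin.append x y j) = Fin.append (v i) w j) →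
            (∀ j, β' (Fin.append x y j) = Fin.append (v i) w' j) →
            uG.eval β = u'.eval β') ∧
        FOC1.IsCombination
          (fun t =>
            (∃ i : ℤ, -1 ≤ i ∧ i ≤ (((l * FOC1.nu (FOC1.degree L A) ((2 * r + 1) * m)) ^ m : ℕ) : ℤ) ∧
              t = .int i) ∨
            FOC1.IsConnectedCount r m (Set.range (Fin.append x y)) t)
          u' := by
  classical
  have hxy : Function.Injective (Fin.append x y) := (Fin.append_injective_iff.1 hxyz).1
  have hZ : (Finset.univ.image z).card ≤ m := Finset.card_image_le.trans (by simp)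
  have hS : (Finset.univ.image (Fin.append (Fin.append x y) z)).Nonempty :=
    ⟨_, Finset.mem_image_of_mem _ (Finset.mem_univ ⟨0, hklm⟩)⟩
  have hSZ : Finset.univ.image (Fin.append (Fin.append x y) z) ∩ Finset.univ.image z =
      Finset.univ.image z := by
    rw [FOC1.image_append]; exact Finset.inter_eq_right.2 Finset.subset_union_right
  obtain ⟨t, ht, hev⟩ := FOC1.isPoly_cnt (V := Set.range (Fin.append x y)) hZ hS
    (by
      intro a ha
      rw [FOC1.image_append, Finset.coe_sdiff, Finset.coe_union, Set.union_sdiff_right] at ha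
      simpa using ha.1)
    (G.map (Fin.append (Fin.append x y) z)) ((FOC1.isLocal_iff_localOn hklm hφ hxyz).1 hloc)
  -- The polynomial `t` is fixed before the structure, and the substitution never increases its
  -- size.
  refine ⟨t.size, fun A _ _ s _ v w => ?_⟩
  obtain ⟨u', h1, h2, h3⟩ := ht.exists_sameValues hxy v w
  obtain ⟨h4, h5⟩ := h2.isFOC1_and_free_subset
  refine ⟨u', ⟨h4, ?_, h1⟩, h5, fun w' hw' i β β' hβ hβ' => ?_, h2⟩
  · refine (Finset.card_le_card (t := Finset.univ.image (Fin.append x y)) ?_).trans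
      (Finset.card_image_le.trans (by simp))
    rw [← Finset.coe_subset]
    simpa using h5
  · rw [← h3 w' hw' i β β' hβ hβ', hev, huG, FOC1.eval_count, hSZ]
    refine FOC1.cnt_congr _ _ fun γ => ?_
    rw [FOC1.realize_and, ← FOC1.realize_delta_comap (P := P) _ hxyz]
    have e : (G.map (Fin.append (Fin.append x y) z)).comap (Fin.append (Fin.append x y) z) = G :=
      SimpleGraph.comap_map_eq ⟨_, hxyz⟩ G
    rw [e]
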